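/- Let $X$ be a complex Banach space, let $k\ge 1$ be an integer and $n=2k+1$ (so $n\ge 3$ is odd), and let $F:\mathbb R^n\to X$ be integrable and $k$ times continuously differentiable. Write $$\hat F(\xi)=\int_{\mathbb R^n}e^{-i\xi\cdot s}F(s)\,ds,\qquad S_R(F)(x)=\frac1{(2\pi)^n}\int_{|\xi|\le R}e^{ix\cdot\xi}\hat F(\xi)\,d\xi\qquad(x,\xi\in\mathbb R^n,\ R\ge 1),$$ where $|\cdot|$ is the Euclidean norm. Assume that for every compact set $K\subset\mathbb R^n$ there exist $\delta>0$ and an integrable function $g:\mathbb R^n\to\mathbb R$ such that $$\sup_{\alpha\in\mathbb N_0^n,\ |\alpha|\le k}\ \sup_{x\in K}\ |y|^{-n+k}\,\bigl\|\nabla^\alpha F(x+y)\bigr\|\le g(y)\qquad\text{for all } y\in\mathbb R^n \text{ with } |y|\ge\delta,$$ where, for a multi-index $\alpha$, $|\alpha|=\alpha_1+\dots+\alpha_n$ and $\nabla^\alpha F=\partial_1^{\alpha_1}\cdots\partial_n^{\alpha_n}F$. Then $S_R(F)(x)\to F(x)$ as $R\to\infty$, locally uniformly in $x\in\mathbb R^n$.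 -/

import Mathlib

open MeasureTheory Filter

noncomputable section

/-- The Fourier transform `F̂(ξ) = ∫ e^{-i ξ·s} F(s) ds` of a vector-valued function on `ℝⁿ`. -/
def fourierHat {n : ℕ} {X : Type*} [NormedAddCommGroup X] [NormedSpace ℂ X]
    (F : EuclideanSpace ℝ (Fin n) → X) (ξ : EuclideanSpace ℝ (Fin n)) : X :=
  ∫ s, Complex.exp (-Complex.I * ((inner ℝ ξ s : ℝ) : ℂ)) • F s

/-- The spherical partial Fourier integral
`S_R(F)(x) = (2π)^{-n} ∫_{|ξ| ≤ R} e^{i x·ξ} F̂(ξ) dξ`. -/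
def sphericalPartialIntegral {n : ℕ} {X : Type*} [NormedAddCommGroup X] [NormedSpace ℂ X]
    (F : EuclideanSpace ℝ (Fin n) → X) (R : ℝ) (x : EuclideanSpace ℝ (Fin n)) : X :=
  (1 / (2 * Real.pi) ^ n : ℝ) •
    ∫ ξ in Metric.closedBall (0 : EuclideanSpace ℝ (Fin n)) R,
      Complex.exp (Complex.I * ((inner ℝ x ξ : ℝ) : ℂ)) • fourierHat F ξ

/-- The partial derivative `∂F/∂x_i`. -/
def partialDeriv {n : ℕ} {X : Type*} [NormedAddCommGroup X] [NormedSpace ℝ X]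
    (i : Fin n) (F : EuclideanSpace ℝ (Fin n) → X) : EuclideanSpace ℝ (Fin n) → X :=
  fun x => lineDeriv ℝ F x (EuclideanSpace.single i 1)

/-- The multi-index derivative `∇^α F = ∂₁^{α₁} ⋯ ∂ₙ^{αₙ} F`. -/
def multiDeriv {n : ℕ} {X : Type*} [NormedAddCommGroup X] [NormedSpace ℝ X]
    (α : Fin n → ℕ) (F : EuclideanSpace ℝ (Fin n) → X) : EuclideanSpace ℝ (Fin n) → X :=
  (List.finRange n).foldr (fun i G => (partialDeriv i)^[α i] G) F

end

/-! Swapping integrals turns `S_R(F)(x)` into a constant times `∫ K_k(R, |y|) F(x + y) dy`, where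
`K_m(R, r) = ∫_{-R}^R (R² - t²)^m e^{irt} dt` is `besselKernel`. Since `n - 1 = 2k`, slicing the
ball gives an integer exponent `k`. These kernels satisfy `∂_r K_m = -(r / (2(m + 1))) K_{m+1}`. In
polar coordinates, `k` integrations by parts along each ray therefore lower `K_k` to `K_0 = 2
sin(Rr)/r`, at the cost of at most `k` radial derivatives. What remains is a fixed combination of
integrals of `e^{±iR|y|}` against `|y|^{-n} DⁱG(y)(y, …, y)` with `i ≤ k`, and these vanish as `R →
∞` by the Riemann-Lebesgue lemma.

The lemma needs integrable densities. At infinity this is the decay hypothesis. At the origin `G`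
has to vanish, so `G(y) = F(x + y) - b(y) F(x)` with a smooth bump `b`, `b 0 = 1`. The subtracted
term contributes `S_R(b)(0) F(x)`, which tends to `F(x)` by Fourier inversion for Schwartz
functions. Local uniformity follows because the densities depend continuously on `x` in `L¹`, while
the oscillating factor has modulus one.

The weight is carried by `hasDerivAt_besselKernel`, `exists_integral_besselKernel_eq_sum`,
`sphericalPartialIntegral_eq`, `exists_integral_besselKernel_bumpDefect` and
`tendsto_integral_exp_norm_smul_family`. -/

/-! ### Multi-index derivatives versus iterated Fréchet derivatives. -/

/-- Iterated partial derivative along a word of coordinate indices. -/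
noncomputable def wordDeriv {n : ℕ} {X : Type*} [NormedAddCommGroup X] [NormedSpace ℝ X]
    (w : List (Fin n)) (F : EuclideanSpace ℝ (Fin n) → X) : EuclideanSpace ℝ (Fin n) → X :=
  w.foldr partialDeriv F

section wordDeriv

variable {n : ℕ} {X : Type*} [NormedAddCommGroup X] [NormedSpace ℝ X]

theorem partialDeriv_eq_fderiv {G : EuclideanSpace ℝ (Fin n) → X} (hG : Differentiable ℝ G)
    (i : Fin n) : partialDeriv i G = fun x => fderiv ℝ G x (EuclideanSpace.single i 1) := by
  funext x
  exact (hG x).lineDeriv_eq_fderiv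

theorem ContDiff.partialDeriv {G : EuclideanSpace ℝ (Fin n) → X} {m : ℕ}
    (hG : ContDiff ℝ (m + 1 : ℕ) G) (i : Fin n) : ContDiff ℝ m (partialDeriv i G) := by
  rw [partialDeriv_eq_fderiv (hG.differentiable (by simp))]
  exact (hG.fderiv_right (m := m) (by simp)).clm_apply contDiff_const

theorem ContDiff.wordDeriv {G : EuclideanSpace ℝ (Fin n) → X} (w : List (Fin n)) {m : ℕ}
    (hG : ContDiff ℝ (m + w.length : ℕ) G) : ContDiff ℝ m (wordDeriv w G) := by
  induction w generalizing m with
  | nil => simpa [_root_.wordDeriv] using hG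
  | cons i w ih =>
    refine ContDiff.partialDeriv (G := _root_.wordDeriv w G) (ih (m := m + 1) ?_) i
    convert hG using 2
    simp; ring

theorem partialDeriv_comm {G : EuclideanSpace ℝ (Fin n) → X} (hG : ContDiff ℝ 2 G)
    (i j : Fin n) : partialDeriv i (partialDeriv j G) = partialDeriv j (partialDeriv i G) := by
  have h1 : Differentiable ℝ G := hG.differentiable (by simp)
  have h2 : Differentiable ℝ (fderiv ℝ G) :=
    (hG.fderiv_right (m := 1) (by norm_num)).differentiable (by simp)
  have key : ∀ i j : Fin n, partialDeriv i (partialDeriv j G) = fun x =>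
      fderiv ℝ (fderiv ℝ G) x (EuclideanSpace.single i 1) (EuclideanSpace.single j 1) := by
    intro i j
    rw [partialDeriv_eq_fderiv h1 j, partialDeriv_eq_fderiv]
    · funext x
      rw [fderiv_clm_apply (h2 x) (by fun_prop)]
      simp
    · exact h2.clm_apply (by fun_prop)
  rw [key, key]
  funext x
  exact (hG.contDiffAt.isSymmSndFDerivAt (by simp)) _ _

theorem wordDeriv_perm {G : EuclideanSpace ℝ (Fin n) → X} {w w' : List (Fin n)} (h : w.Perm w')
    (hG : ContDiff ℝ w.length G) : wordDeriv w G = wordDeriv w' G := by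
  induction h with
  | nil => rfl
  | @cons i l l' _ ih =>
    have := ih (hG.of_le (by simp))
    simp only [wordDeriv, List.foldr_cons] at this ⊢
    rw [this]
  | swap i j l =>
    refine partialDeriv_comm (G := wordDeriv l G) (ContDiff.wordDeriv l (m := 2) ?_) j i
    convert hG using 2
    simp; ring
  | trans h1 h2 ih1 ih2 =>
    rw [ih1 hG, ih2 (by rwa [← h1.length_eq])]

theorem foldr_iterate_partialDeriv (α : Fin n → ℕ) (F : EuclideanSpace ℝ (Fin n) → X)
    (l : List (Fin n)) :
    l.foldr (fun i G => (partialDeriv i)^[α i] G) F =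
      wordDeriv (l.flatMap fun i => List.replicate (α i) i) F := by
  induction l with
  | nil => rfl
  | cons i l ih =>
    simp only [List.foldr_cons, List.flatMap_cons, ih, wordDeriv, List.foldr_append]
    generalize List.foldr partialDeriv F _ = G
    induction α i with
    | zero => rfl
    | succ m ihm => rw [Function.iterate_succ_apply', List.replicate_succ, List.foldr_cons, ihm]

/-- By symmetry of mixed partials a word matters only through its letter counts, so every word
derivative is covered by the multi-index hypothesis. -/
theorem multiDeriv_count {F : EuclideanSpace ℝ (Fin n) → X} (w : List (Fin n))
    (hF : ContDiff ℝ w.length F) : multiDeriv (fun i => w.count i) F = wordDeriv w F := by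
  rw [multiDeriv, foldr_iterate_partialDeriv]
  refine (wordDeriv_perm ?_ hF).symm
  rw [List.perm_iff_count]
  intro a
  rw [List.count_flatMap]
  simp only [Function.comp_def, List.count_replicate]
  rw [← List.ofFn_eq_map, List.sum_ofFn]
  simp

theorem sum_count_eq_length (w : List (Fin n)) : ∑ i, w.count i = w.length := by
  simpa using Multiset.sum_count_eq_card (s := Finset.univ) (m := (w : Multiset (Fin n))) (by simp)

theorem iteratedFDeriv_single_eq_wordDeriv {F : EuclideanSpace ℝ (Fin n) → X} (j : ℕ)
    (hF : ContDiff ℝ j F) (i : Fin j → Fin n) (z : EuclideanSpace ℝ (Fin n)) :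
    iteratedFDeriv ℝ j F z (fun l => EuclideanSpace.single (i l) 1) =
      wordDeriv (List.ofFn i) F z := by
  induction j generalizing z with
  | zero => simp [wordDeriv]
  | succ j ih =>
    have hF' : ContDiff ℝ j F := hF.of_le (by simp)
    have hd : Differentiable ℝ (iteratedFDeriv ℝ j F) :=
      hF.differentiable_iteratedFDeriv (by exact_mod_cast Nat.lt_succ_self j)
    have hw : ContDiff ℝ 1 (wordDeriv (List.ofFn fun l => i l.succ) F) :=
      ContDiff.wordDeriv _ (m := 1) (by convert hF using 2; simp; ring)
    rw [iteratedFDeriv_succ_apply_left, List.ofFn_succ]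
    change _ = partialDeriv (i 0) (wordDeriv (List.ofFn fun l => i l.succ) F) z
    rw [partialDeriv_eq_fderiv (hw.differentiable (by simp))]
    have : wordDeriv (List.ofFn fun l => i l.succ) F = fun z => iteratedFDeriv ℝ j F z
        (fun l => EuclideanSpace.single (i l.succ) 1) := by
      funext z; rw [ih hF']
    rw [this]
    exact (fderiv_continuousMultilinear_apply_const_apply (hd z) _ _).symm

/-- Expanding `y` in the standard basis produces one term for each of the `n ^ j` words of length
`j`, with coefficient at most `‖y‖ ^ j`. -/
theorem norm_iteratedFDeriv_apply_le_of_multiDeriv {F : EuclideanSpace ℝ (Fin n) → X} {k : ℕ}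
    (hF : ContDiff ℝ k F) {z : EuclideanSpace ℝ (Fin n)} {B : ℝ}
    (hB : ∀ α : Fin n → ℕ, ∑ i, α i ≤ k → ‖multiDeriv α F z‖ ≤ B) {j : ℕ} (hj : j ≤ k)
    (y : EuclideanSpace ℝ (Fin n)) :
    ‖iteratedFDeriv ℝ j F z (fun _ => y)‖ ≤ n ^ j * ‖y‖ ^ j * B := by
  have hFj : ContDiff ℝ j F := hF.of_le (by exact_mod_cast hj)
  have hy : y = ∑ i, y i • EuclideanSpace.single i (1 : ℝ) := by
    ext l; simp [Finset.sum_apply, Pi.single_apply]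
  have h1 : iteratedFDeriv ℝ j F z (fun _ => y) = ∑ i : Fin j → Fin n,
      (∏ l, y (i l)) • wordDeriv (List.ofFn i) F z := by
    conv_lhs => rw [hy]
    rw [ContinuousMultilinearMap.map_sum]
    refine Finset.sum_congr rfl fun i _ => ?_
    rw [ContinuousMultilinearMap.map_smul_univ, iteratedFDeriv_single_eq_wordDeriv j hFj]
  rw [h1]
  calc _ ≤ ∑ i : Fin j → Fin n, ‖y‖ ^ j * B := by
        refine norm_sum_le_of_le _ fun i _ => ?_
        rw [norm_smul]
        have h2 : ‖∏ l, y (i l)‖ ≤ ‖y‖ ^ j := by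
          rw [norm_prod]
          refine (Finset.prod_le_prod (fun _ _ => norm_nonneg _)
            fun l _ => PiLp.norm_apply_le y (i l)).trans ?_
          simp
        have h3 : ‖wordDeriv (List.ofFn i) F z‖ ≤ B := by
          rw [← multiDeriv_count _ (by simpa using hFj)]
          refine hB _ ?_
          rw [sum_count_eq_length]; simpa using hj
        gcongr
    _ = _ := by simp [mul_assoc]

end wordDeriv

/-! ### The one-dimensional kernels: decay and recursion. -/

/-- The kernel `∫_{-R}^R (R² - t²)^m e^{i t r} dt`. -/
noncomputable def besselKernel (m : ℕ) (R r : ℝ) : ℂ :=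
  ∫ t in (-R)..R, ((R : ℂ) ^ 2 - (t : ℂ) ^ 2) ^ m * Complex.exp (Complex.I * r * t)

section besselKernel

theorem norm_exp_I_mul_mul_ofReal (r t : ℝ) : ‖Complex.exp (Complex.I * r * t)‖ = 1 := by
  rw [mul_assoc, mul_comm, ← Complex.ofReal_mul, Complex.norm_exp_ofReal_mul_I]

theorem hasDerivAt_exp_I_mul_mul_ofReal (r t : ℝ) :
    HasDerivAt (fun t : ℝ => Complex.exp (Complex.I * r * t))
      (Complex.exp (Complex.I * r * t) * (Complex.I * r)) t := by
  have := ((hasDerivAt_id (t : ℂ)).const_mul (Complex.I * r)).cexp.comp_ofReal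
  simpa using this

theorem exists_norm_besselKernel_le (m : ℕ) (R : ℝ) : ∃ C, ∀ r, ‖besselKernel m R r‖ ≤ C := by
  refine ⟨|∫ t in (-R)..R, ‖((R : ℂ) ^ 2 - (t : ℂ) ^ 2) ^ m‖|,
    fun r => (intervalIntegral.norm_integral_le_abs_integral_norm).trans_eq ?_⟩
  simp [norm_exp_I_mul_mul_ofReal]

/-- The weight vanishes to order `m` at `±R`, so `m` integrations by parts gain `r⁻¹` each without
boundary terms, and a last one gains one more. The polynomial `q` makes the induction close. The
dependence of `C` on `R` is harmless: the bound only serves integrability for fixed `R`. -/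
theorem exists_norm_integral_pow_mul_exp_le (R : ℝ) (m : ℕ) (q : Polynomial ℂ) :
    ∃ C, ∀ r : ℝ, 0 < r → ‖∫ t in (-R)..R, ((R : ℂ) ^ 2 - (t : ℂ) ^ 2) ^ m * q.eval (t : ℂ) *
      Complex.exp (Complex.I * r * t)‖ ≤ C / r ^ (m + 1) := by
  have hq : ∀ q : Polynomial ℂ, Continuous fun t : ℝ => q.eval (t : ℂ) := fun q =>
    q.continuous.comp Complex.continuous_ofReal
  have hqd : ∀ (q : Polynomial ℂ) (t : ℝ),
      HasDerivAt (fun t : ℝ => q.eval (t : ℂ)) (q.derivative.eval (t : ℂ)) t := fun q t =>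
    (q.hasDerivAt (t : ℂ)).comp_ofReal
  induction m generalizing q with
  | zero =>
    refine ⟨‖q.eval (R : ℂ)‖ + ‖q.eval ((-R : ℝ) : ℂ)‖ +
      |∫ t in (-R)..R, ‖q.derivative.eval (t : ℂ)‖|, fun r hr => ?_⟩
    have h1 := intervalIntegral.integral_eq_sub_of_hasDerivAt (a := -R) (b := R)
      (fun t _ => (hqd q t).mul (hasDerivAt_exp_I_mul_mul_ofReal r t))
      (Continuous.intervalIntegrable (by have := hq q; have := hq q.derivative; fun_prop) _ _)
    rw [intervalIntegral.integral_add
      (Continuous.intervalIntegrable (by have := hq q.derivative; fun_prop) _ _)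
      (Continuous.intervalIntegrable (by have := hq q; fun_prop) _ _)] at h1
    simp only [← mul_assoc] at h1
    simp only [intervalIntegral.integral_mul_const] at h1
    have h2 := eq_sub_of_add_eq' h1
    have h3 : ‖∫ t in (-R)..R, q.derivative.eval (t : ℂ) * Complex.exp (Complex.I * r * t)‖ ≤
        |∫ t in (-R)..R, ‖q.derivative.eval (t : ℂ)‖| := by
      refine intervalIntegral.norm_integral_le_abs_integral_norm.trans_eq ?_
      simp [norm_exp_I_mul_mul_ofReal]
    rw [le_div_iff₀ (by positivity)]
    have h4 := congrArg norm h2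
    simp only [norm_mul, Complex.norm_I, Complex.norm_real, Real.norm_of_nonneg hr.le] at h4
    simp only [pow_zero, one_mul, zero_add, pow_one]
    rw [mul_one] at h4
    rw [h4]
    refine (norm_sub_le _ _).trans (add_le_add ((norm_sub_le _ _).trans ?_) h3)
    simp [norm_exp_I_mul_mul_ofReal]
    have := norm_exp_I_mul_mul_ofReal r (-R)
    simp at this
    simp [this]
  | succ m ih =>
    -- This polynomial is the cofactor of `(R² - t²)^m` in the derivative of `(R² - t²)^(m+1) q`.
    obtain ⟨C, hC⟩ := ih (Polynomial.C (-2 * (m + 1 : ℂ)) * Polynomial.X * q +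
      (Polynomial.C ((R : ℂ) ^ 2) - Polynomial.X ^ 2) * q.derivative)
    refine ⟨C, fun r hr => ?_⟩
    have hw : ∀ t : ℝ, HasDerivAt (fun t : ℝ => ((R : ℂ) ^ 2 - (t : ℂ) ^ 2) ^ (m + 1))
        ((m + 1) * ((R : ℂ) ^ 2 - (t : ℂ) ^ 2) ^ m * (-(2 * t))) t := by
      intro t
      have := ((((hasDerivAt_id (t : ℂ)).pow 2).const_sub ((R : ℂ) ^ 2)).pow (m + 1)).comp_ofReal
      simpa using this
    have hwq : ∀ t : ℝ, HasDerivAt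
        (fun t : ℝ => ((R : ℂ) ^ 2 - (t : ℂ) ^ 2) ^ (m + 1) * q.eval (t : ℂ)) _ t :=
      fun t => (hw t).mul (hqd q t)
    have h1 := intervalIntegral.integral_eq_sub_of_hasDerivAt (a := -R) (b := R)
      (fun t _ => (hwq t).mul (hasDerivAt_exp_I_mul_mul_ofReal r t))
      (Continuous.intervalIntegrable (by have := hq q; have := hq q.derivative; fun_prop) _ _)
    rw [intervalIntegral.integral_add
      (Continuous.intervalIntegrable
        (by have := hq q; have := hq q.derivative; fun_prop) _ _)
      (Continuous.intervalIntegrable (by have := hq q; fun_prop) _ _)] at h1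
    simp only [← mul_assoc] at h1
    simp only [intervalIntegral.integral_mul_const] at h1
    have h2 := eq_sub_of_add_eq' h1
    have h4 := congrArg norm h2
    simp only [norm_mul, Complex.norm_I, Complex.norm_real, Real.norm_of_nonneg hr.le] at h4
    rw [mul_one] at h4
    rw [pow_succ r, ← div_div, le_div_iff₀ hr, h4]
    refine le_trans (le_of_eq ?_) (hC r hr)
    simp only [Pi.mul_apply, Complex.ofReal_neg, neg_sq, sub_self, zero_sub, ne_eq,
      Nat.add_eq_zero_iff, one_ne_zero, and_false, not_false_eq_true, zero_pow, zero_mul, norm_neg]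
    congr 1
    refine intervalIntegral.integral_congr fun t _ => ?_
    simp
    ring

theorem exists_norm_besselKernel_le_div (m : ℕ) (R : ℝ) :
    ∃ C, ∀ r, 0 < r → ‖besselKernel m R r‖ ≤ C / r ^ (m + 1) := by
  simpa [besselKernel] using exists_norm_integral_pow_mul_exp_le R m 1

theorem besselKernel_zero {r : ℝ} (hr : r ≠ 0) (R : ℝ) : besselKernel 0 R r =
    (Complex.exp (Complex.I * r * R) - Complex.exp (-(Complex.I * r * R))) / (Complex.I * r) := by
  have h := integral_exp_mul_complex (a := -R) (b := R) (c := Complex.I * r) (by simp [hr])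
  simpa [besselKernel] using h

/-- Differentiating under the integral brings down `i t`, and `t (R² - t²)^m` is the derivative of
`-(R² - t²)^(m+1) / (2(m + 1))`; integrating by parts, the boundary terms vanish. -/
theorem hasDerivAt_besselKernel (m : ℕ) (R r : ℝ) : HasDerivAt (besselKernel m R)
    (-(r / (2 * (m + 1))) * besselKernel (m + 1) R r) r := by
  have h0 : ∀ r t : ℝ, HasDerivAt (fun r : ℝ => Complex.exp (Complex.I * r * t))
      (Complex.exp (Complex.I * r * t) * (Complex.I * t)) r := by
    intro r t
    have := (((hasDerivAt_id (r : ℂ)).const_mul Complex.I).mul_const (t : ℂ)).cexp.comp_ofReal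
    simpa using this
  have h1 := (intervalIntegral.hasDerivAt_integral_of_dominated_loc_of_deriv_le
    (μ := volume) (a := -R) (b := R) (x₀ := r) (s := Set.univ)
    (F := fun (r t : ℝ) => ((R : ℂ) ^ 2 - (t : ℂ) ^ 2) ^ m * Complex.exp (Complex.I * r * t))
    (F' := fun (r t : ℝ) => ((R : ℂ) ^ 2 - (t : ℂ) ^ 2) ^ m *
      (Complex.exp (Complex.I * r * t) * (Complex.I * t)))
    (bound := fun t => ‖((R : ℂ) ^ 2 - (t : ℂ) ^ 2) ^ m‖ * |t|) Filter.univ_mem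
    (Eventually.of_forall fun r => Continuous.aestronglyMeasurable (by fun_prop))
    (Continuous.intervalIntegrable (by fun_prop) _ _)
    (Continuous.aestronglyMeasurable (by fun_prop))
    (Eventually.of_forall fun t _ r _ => by simp [norm_exp_I_mul_mul_ofReal])
    (Continuous.intervalIntegrable (by fun_prop) _ _)
    (Eventually.of_forall fun t _ r _ => (h0 r t).const_mul _)).2
  refine h1.congr_deriv ?_
  have hw : ∀ t : ℝ, HasDerivAt (fun t : ℝ => ((R : ℂ) ^ 2 - (t : ℂ) ^ 2) ^ (m + 1))
      ((m + 1) * ((R : ℂ) ^ 2 - (t : ℂ) ^ 2) ^ m * (-(2 * t))) t := by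
    intro t
    have := ((((hasDerivAt_id (t : ℂ)).pow 2).const_sub ((R : ℂ) ^ 2)).pow (m + 1)).comp_ofReal
    simpa using this
  have h2 := intervalIntegral.integral_eq_sub_of_hasDerivAt (a := -R) (b := R)
    (fun t _ => (hw t).mul (hasDerivAt_exp_I_mul_mul_ofReal r t))
    (Continuous.intervalIntegrable (by fun_prop) _ _)
  rw [intervalIntegral.integral_add (Continuous.intervalIntegrable (by fun_prop) _ _)
    (Continuous.intervalIntegrable (by fun_prop) _ _)] at h2
  simp only [Pi.mul_apply, Complex.ofReal_neg, neg_sq, sub_self, ne_eq, Nat.add_eq_zero_iff,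
      one_ne_zero, and_false, not_false_eq_true, zero_pow, zero_mul] at h2
  have e1 : ∀ t : ℝ, (m + 1) * ((R : ℂ) ^ 2 - (t : ℂ) ^ 2) ^ m * (-(2 * t)) *
      Complex.exp (Complex.I * r * t) = (((R : ℂ) ^ 2 - (t : ℂ) ^ 2) ^ m *
      (Complex.exp (Complex.I * r * t) * (Complex.I * t))) * (2 * (m + 1) * Complex.I) := by
    intro t
    linear_combination (-2 * (m + 1) * ((R : ℂ) ^ 2 - (t : ℂ) ^ 2) ^ m *
      Complex.exp (Complex.I * r * t) * t) * Complex.I_sq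
  simp only [e1, ← mul_assoc (((R : ℂ) ^ 2 - (_ : ℂ) ^ 2) ^ (m + 1))] at h2
  simp only [intervalIntegral.integral_mul_const] at h2
  change _ + besselKernel (m + 1) R r * _ = 0 at h2
  have hm : (m + 1 : ℂ) ≠ 0 := by exact_mod_cast Nat.succ_ne_zero m
  have h3 : (Complex.I * (2 * (m + 1) : ℂ)) ≠ 0 := mul_ne_zero Complex.I_ne_zero (by simpa using hm)
  have h4 : (r : ℂ) / (2 * (m + 1)) * (2 * (m + 1)) = r :=
    div_mul_cancel₀ _ (by simpa using hm)
  refine mul_left_cancel₀ h3 ?_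
  linear_combination h2 + Complex.I * besselKernel (m + 1) R r * h4

theorem continuous_besselKernel (m : ℕ) (R : ℝ) : Continuous (besselKernel m R) :=
  continuous_iff_continuousAt.2 fun r => (hasDerivAt_besselKernel m R r).continuousAt

end besselKernel

/-! ### Integration by parts along a ray. -/

section ray

variable {X : Type*} [NormedAddCommGroup X] [NormedSpace ℂ X]

theorem integrableOn_besselKernel_mul_pow_smul {k m p : ℕ} (hp : p ≤ m + 1 + k) (R : ℝ) {δ : ℝ}
    (hδ : 1 ≤ δ) {f : ℝ → X} (hc : Continuous f)
    (hf : IntegrableOn (fun r : ℝ => r ^ k • f r) (Set.Ioi δ)) :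
    IntegrableOn (fun r : ℝ => (besselKernel m R r * (r : ℂ) ^ p) • f r) (Set.Ioi 0) := by
  have hcont : Continuous fun r : ℝ => (besselKernel m R r * (r : ℂ) ^ p) • f r := by
    have := continuous_besselKernel m R
    fun_prop
  rw [← Set.Ioc_union_Ioi_eq_Ioi (zero_le_one.trans hδ)]
  refine IntegrableOn.union (hcont.integrableOn_Ioc) ?_
  obtain ⟨C, hC⟩ := exists_norm_besselKernel_le_div m R
  refine Integrable.mono' (hf.norm.const_mul C) hcont.aestronglyMeasurable ?_
  filter_upwards [ae_restrict_mem measurableSet_Ioi] with r hr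
  have hr1 : 1 ≤ r := hδ.trans (le_of_lt hr)
  have hr0 : 0 < r := by linarith
  have hC0 : 0 ≤ C / r ^ (m + 1) := (norm_nonneg _).trans (hC r hr0)
  rw [norm_smul, norm_smul, norm_mul, norm_pow, norm_pow, Complex.norm_real,
    Real.norm_of_nonneg hr0.le, ← mul_assoc]
  refine mul_le_mul_of_nonneg_right ?_ (norm_nonneg _)
  calc ‖besselKernel m R r‖ * r ^ p ≤ C / r ^ (m + 1) * r ^ (m + 1 + k) := by
        gcongr
        exact hC r hr0
    _ = C * r ^ k := by rw [pow_add _ (m + 1) k, ← mul_assoc, div_mul_cancel₀ _ (by positivity)]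

variable [CompleteSpace X]

/-- Up to a constant, `r K_{m+1}` is the derivative of `K_m`; the remaining factor `r^(2m+1+j) f` is
differentiated instead. The condition `m + j ≤ k` is exactly what the kernel decay `r^(-m-1)` and
the weight `r^k` allow. -/
theorem integral_besselKernel_succ {k m j : ℕ} (hmj : m + j ≤ k) (R : ℝ) {δ : ℝ}
    (hδ : 1 ≤ δ) {f f' : ℝ → X} (hd : ∀ r, HasDerivAt f (f' r) r) (hc' : Continuous f')
    (hf : IntegrableOn (fun r : ℝ => r ^ k • f r) (Set.Ioi δ))
    (hf' : IntegrableOn (fun r : ℝ => r ^ k • f' r) (Set.Ioi δ)) :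
    ∫ r in Set.Ioi (0 : ℝ), (besselKernel (m + 1) R r * (r : ℂ) ^ (2 * (m + 1) + j)) • f r =
      (2 * (m + 1) * (2 * m + 1 + j) : ℂ) •
        (∫ r in Set.Ioi (0 : ℝ), (besselKernel m R r * (r : ℂ) ^ (2 * m + j)) • f r) +
      (2 * (m + 1) : ℂ) •
        ∫ r in Set.Ioi (0 : ℝ), (besselKernel m R r * (r : ℂ) ^ (2 * m + (j + 1))) • f' r := by
  have hc : Continuous f := continuous_iff_continuousAt.2 fun r => (hd r).continuousAt
  have hm : (2 * (m + 1) : ℂ) ≠ 0 := by exact_mod_cast Nat.succ_ne_zero (2 * m + 1)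
  have i1 := integrableOn_besselKernel_mul_pow_smul (m := m + 1) (p := 2 * (m + 1) + j)
    (by omega) R hδ hc hf
  have i2 := integrableOn_besselKernel_mul_pow_smul (m := m) (p := 2 * m + j)
    (by omega) R hδ hc hf
  have i3 := integrableOn_besselKernel_mul_pow_smul (m := m) (p := 2 * m + (j + 1))
    (by omega) R hδ hc' hf'
  have i4 := integrableOn_besselKernel_mul_pow_smul (m := m) (p := 2 * m + 1 + j)
    (by omega) R hδ hc hf
  have hP : ∀ r : ℝ, HasDerivAt
      (fun r : ℝ => (besselKernel m R r * (r : ℂ) ^ (2 * m + 1 + j)) • f r)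
      ((-(2 * (m + 1) : ℂ)⁻¹) • ((besselKernel (m + 1) R r * (r : ℂ) ^ (2 * (m + 1) + j)) • f r) +
        (2 * m + 1 + j : ℂ) • ((besselKernel m R r * (r : ℂ) ^ (2 * m + j)) • f r) +
        (besselKernel m R r * (r : ℂ) ^ (2 * m + (j + 1))) • f' r) r := by
    intro r
    have hp : HasDerivAt (fun r : ℝ => (r : ℂ) ^ (2 * m + 1 + j))
        ((2 * m + 1 + j : ℂ) * (r : ℂ) ^ (2 * m + j)) r := by
      have := ((hasDerivAt_id (r : ℂ)).pow (2 * m + 1 + j)).comp_ofReal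
      have e : 2 * m + 1 + j - 1 = 2 * m + j := by omega
      simpa [e] using this
    refine (((hasDerivAt_besselKernel m R r).mul hp).smul (hd r)).congr_deriv ?_
    rw [add_comm, smul_smul, smul_smul, ← add_smul]
    have e : 2 * m + 1 + j = 2 * m + (j + 1) := by ring
    rw [Pi.mul_apply, e]
    congr 2
    field_simp
    ring
  have iP : IntegrableOn (fun r : ℝ =>
      ((-(2 * (m + 1) : ℂ)⁻¹) • ((besselKernel (m + 1) R r * (r : ℂ) ^ (2 * (m + 1) + j)) • f r) +
        (2 * m + 1 + j : ℂ) • ((besselKernel m R r * (r : ℂ) ^ (2 * m + j)) • f r) +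
        (besselKernel m R r * (r : ℂ) ^ (2 * m + (j + 1))) • f' r)) (Set.Ioi 0) :=
    ((i1.smul (-(2 * (m + 1) : ℂ)⁻¹)).add (i2.smul (2 * m + 1 + j : ℂ))).add i3
  -- At infinity the boundary term vanishes since the product and its derivative are both
  -- integrable; at `0` the positive power of `r` kills it.
  have hlim := tendsto_zero_of_hasDerivAt_of_integrableOn_Ioi (fun r _ => hP r) iP i4
  have h := integral_Ioi_of_hasDerivAt_of_tendsto' (fun r _ => hP r) iP hlim
  have i1' := i1.smul (-(2 * (m + 1) : ℂ)⁻¹)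
  have i2' := i2.smul (2 * m + 1 + j : ℂ)
  have i12 := i1'.add i2'
  simp only [Pi.add_def, Pi.smul_def] at i1' i2' i12
  rw [integral_add i12 i3, integral_add i1' i2', integral_smul, integral_smul] at h
  simp only [Complex.ofReal_zero, ne_eq, Nat.add_eq_zero_iff, one_ne_zero, and_false, false_and,
    not_false_eq_true, zero_pow, mul_zero, zero_smul, sub_self, neg_smul] at h
  have h2 := congrArg (fun v => (2 * (m + 1) : ℂ) • v) h
  simp only [smul_add, smul_neg, smul_smul, smul_zero, mul_inv_cancel₀ hm, one_smul] at h2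
  rw [add_assoc] at h2
  exact (neg_add_eq_zero.1 h2)

-- The coefficients are chosen before `R`, `δ` and `f`: one set must serve all rays, all `x` and all
-- `R` when the limit is taken.
variable (X) in
theorem exists_integral_besselKernel_eq_sum (k m : ℕ) : ∀ j, m + j ≤ k + 1 → ∃ c : ℕ → ℂ,
    ∀ (R δ : ℝ), 1 ≤ δ → ∀ f : ℕ → ℝ → X,
      (∀ i ≤ k, ∀ r, HasDerivAt (f i) (f (i + 1) r) r) → (∀ i ≤ k + 1, Continuous (f i)) →
      (∀ i ≤ k + 1, IntegrableOn (fun r : ℝ => r ^ k • f i r) (Set.Ioi δ)) →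
      ∫ r in Set.Ioi (0 : ℝ), (besselKernel m R r * (r : ℂ) ^ (2 * m + j)) • f j r =
        ∑ i ∈ Finset.range (m + 1), c i •
          ∫ r in Set.Ioi (0 : ℝ), (besselKernel 0 R r * (r : ℂ) ^ (j + i)) • f (j + i) r := by
  induction m with
  | zero =>
    intro j _
    exact ⟨fun _ => 1, fun R δ _ f _ _ _ => by simp⟩
  | succ m ih =>
    intro j hj
    obtain ⟨c₁, h₁⟩ := ih j (by omega)
    obtain ⟨c₂, h₂⟩ := ih (j + 1) (by omega)
    -- The term that keeps `f j` contributes `c₁`; the term with `f (j + 1)` contributes `c₂`,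
    -- shifted by one.
    refine ⟨fun i => (2 * (m + 1) * (2 * m + 1 + j) : ℂ) * (if i < m + 1 then c₁ i else 0) +
      (2 * (m + 1) : ℂ) * (if i = 0 then 0 else c₂ (i - 1)), fun R δ hδ f hd hc hi => ?_⟩
    rw [integral_besselKernel_succ (by omega : m + j ≤ k) R hδ (hd j (by omega))
      (hc _ (by omega)) (hi _ (by omega)) (hi _ (by omega)), h₁ R δ hδ f hd hc hi,
      h₂ R δ hδ f hd hc hi]
    generalize (2 * (m + 1) * (2 * m + 1 + j) : ℂ) = a
    generalize (2 * (m + 1) : ℂ) = b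
    simp only [add_smul, Finset.sum_add_distrib, mul_smul a, mul_smul b, ← Finset.smul_sum]
    congr 2
    · rw [Finset.sum_range_succ _ (m + 1)]
      simp only [lt_irrefl, if_false, zero_smul, add_zero]
      exact Finset.sum_congr rfl fun i hi => by rw [if_pos (Finset.mem_range.1 hi)]
    · rw [Finset.sum_range_succ' _ (m + 1)]
      simp [add_comm, add_left_comm]

end ray

/-! ### The Fourier transform of a ball in odd dimension. -/

section slicing

/-- Splitting off the first coordinate of Euclidean space. -/
noncomputable def euclideanConsEquiv (d : ℕ) :
    ℝ × EuclideanSpace ℝ (Fin d) ≃ᵐ EuclideanSpace ℝ (Fin (d + 1)) :=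
  (((MeasurableEquiv.refl ℝ).prodCongr (MeasurableEquiv.toLp 2 (Fin d → ℝ)).symm).trans
    (MeasurableEquiv.piFinSuccAbove (fun _ => ℝ) 0).symm).trans
      (MeasurableEquiv.toLp 2 (Fin (d + 1) → ℝ))

theorem measurePreserving_euclideanConsEquiv (d : ℕ) :
    MeasurePreserving (euclideanConsEquiv d) := by
  refine MeasurePreserving.trans (MeasurePreserving.trans ?_
    (volume_preserving_piFinSuccAbove (fun _ : Fin (d + 1) => ℝ) 0).symm)
    (PiLp.volume_preserving_toLp (Fin (d + 1)))
  exact (MeasurePreserving.id volume).prod (PiLp.volume_preserving_ofLp (Fin d))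

theorem euclideanConsEquiv_apply_zero (d : ℕ) (p : ℝ × EuclideanSpace ℝ (Fin d)) :
    euclideanConsEquiv d p 0 = p.1 := by
  simp [euclideanConsEquiv, MeasurableEquiv.piFinSuccAbove]
  rfl

theorem norm_sq_euclideanConsEquiv (d : ℕ) (p : ℝ × EuclideanSpace ℝ (Fin d)) :
    ‖euclideanConsEquiv d p‖ ^ 2 = p.1 ^ 2 + ‖p.2‖ ^ 2 := by
  rw [EuclideanSpace.norm_sq_eq, EuclideanSpace.norm_sq_eq, Fin.sum_univ_succ]
  simp [euclideanConsEquiv, MeasurableEquiv.piFinSuccAbove]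
  rfl

/-- The slice of the ball at first coordinate `t` is a `2k`-dimensional ball of radius `√(R² - t²)`,
whose volume is proportional to `(R² - t²)^k`. -/
theorem setIntegral_closedBall_comp_apply_zero (k : ℕ) {R : ℝ} (hR : 0 ≤ R) {g : ℝ → ℂ}
    (hg : Continuous g) :
    ∫ ξ in Metric.closedBall (0 : EuclideanSpace ℝ (Fin (2 * k + 1))) R, g (ξ 0) =
      ((volume.real (Metric.ball (0 : EuclideanSpace ℝ (Fin (2 * k))) 1) : ℝ) : ℂ) *
        ∫ t in (-R)..R, ((R : ℂ) ^ 2 - (t : ℂ) ^ 2) ^ k * g t := by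
  have hint : IntegrableOn (fun ξ : EuclideanSpace ℝ (Fin (2 * k + 1)) => g (ξ 0))
      (Metric.closedBall 0 R) :=
    ContinuousOn.integrableOn_compact (isCompact_closedBall _ _) (by fun_prop)
  rw [← integrable_indicator_iff measurableSet_closedBall] at hint
  rw [← integral_indicator measurableSet_closedBall,
    ← (measurePreserving_euclideanConsEquiv (2 * k)).integral_comp']
  have hint' := (measurePreserving_euclideanConsEquiv (2 * k)).integrable_comp_of_integrable hint
  rw [Function.comp_def] at hint'
  rw [Measure.volume_eq_prod] at hint' ⊢
  rw [integral_prod _ hint', intervalIntegral.integral_of_le (by linarith),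
    ← integral_Icc_eq_integral_Ioc, ← integral_const_mul,
    ← integral_indicator measurableSet_Icc]
  congr 1
  funext t
  have hmem : ∀ z : EuclideanSpace ℝ (Fin (2 * k)),
      euclideanConsEquiv (2 * k) (t, z) ∈ Metric.closedBall 0 R ↔
        t ^ 2 + ‖z‖ ^ 2 ≤ R ^ 2 := fun z => by
    rw [mem_closedBall_zero_iff, ← norm_sq_euclideanConsEquiv _ (t, z),
      sq_le_sq₀ (norm_nonneg _) hR]
  by_cases ht : t ∈ Set.Icc (-R) R
  · have ht2 : 0 ≤ R ^ 2 - t ^ 2 := sub_nonneg.2 (sq_le_sq.2 (by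
      rw [abs_of_nonneg hR]; exact abs_le.2 ht))
    rw [Set.indicator_of_mem ht]
    have h1 : ∀ z : EuclideanSpace ℝ (Fin (2 * k)),
        (Metric.closedBall 0 R).indicator (fun ξ => g (ξ 0)) (euclideanConsEquiv (2 * k) (t, z)) =
          (Metric.closedBall (0 : EuclideanSpace ℝ (Fin (2 * k))) √(R ^ 2 - t ^ 2)).indicator
            (fun _ => g t) z := by
      intro z
      classical
      simp only [Set.indicator_apply, hmem, euclideanConsEquiv_apply_zero]
      refine if_congr ?_ rfl rfl
      rw [mem_closedBall_zero_iff, Real.le_sqrt (norm_nonneg _) ht2]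
      constructor <;> intro h <;> linarith
    simp only [h1]
    rw [integral_indicator measurableSet_closedBall, setIntegral_const, Measure.real,
      Measure.addHaar_closedBall _ _ (Real.sqrt_nonneg _), ENNReal.toReal_mul,
      ENNReal.toReal_ofReal (by positivity), finrank_euclideanSpace_fin, pow_mul,
      Real.sq_sqrt ht2, Complex.real_smul]
    push_cast [Measure.real]
    ring
  · rw [Set.indicator_of_notMem ht]
    refine integral_eq_zero_of_ae (Eventually.of_forall fun z => ?_)
    refine Set.indicator_of_notMem (fun h => ht ?_) _
    rw [hmem] at h
    refine abs_le.1 (abs_le_of_sq_le_sq ?_ hR)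
    nlinarith [sq_nonneg ‖z‖]

theorem setIntegral_closedBall_exp_inner (k : ℕ) {R : ℝ} (hR : 0 ≤ R)
    (y : EuclideanSpace ℝ (Fin (2 * k + 1))) :
    ∫ ξ in Metric.closedBall (0 : EuclideanSpace ℝ (Fin (2 * k + 1))) R,
        Complex.exp (Complex.I * ((inner ℝ y ξ : ℝ) : ℂ)) =
      ((volume.real (Metric.ball (0 : EuclideanSpace ℝ (Fin (2 * k))) 1) : ℝ) : ℂ) *
        besselKernel k R ‖y‖ := by
  set e : EuclideanSpace ℝ (Fin (2 * k + 1)) := EuclideanSpace.single 0 ‖y‖ with he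
  -- Reflection in the hyperplane orthogonal to `e - y` sends `e` to `y`, as the two have equal
  -- norm.
  obtain ⟨ρ, hρ⟩ : ∃ ρ : EuclideanSpace ℝ (Fin (2 * k + 1)) ≃ₗᵢ[ℝ]
      EuclideanSpace ℝ (Fin (2 * k + 1)), ρ e = y :=
    ⟨(ℝ ∙ (e - y))ᗮ.reflection, Submodule.reflection_sub (by simp [he])⟩
  have h1 := ρ.measurePreserving.setIntegral_preimage_emb ρ.toHomeomorph.measurableEmbedding
    (fun ξ => Complex.exp (Complex.I * ((inner ℝ y ξ : ℝ) : ℂ))) (Metric.closedBall 0 R)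
  rw [← h1, besselKernel, ← setIntegral_closedBall_comp_apply_zero k hR
    (g := fun t => Complex.exp (Complex.I * ‖y‖ * t)) (by fun_prop)]
  have h2 : ρ ⁻¹' Metric.closedBall 0 R = Metric.closedBall 0 R := by
    ext z; simp
  rw [h2]
  congr 1
  funext z
  rw [← hρ, ρ.inner_map_map, hρ, he]
  simp [EuclideanSpace.inner_single_left, mul_assoc]

end slicing

/-! ### The partial integral as a convolution with the kernel. -/

section partialIntegral

variable {X : Type*} [NormedAddCommGroup X] [NormedSpace ℂ X] [CompleteSpace X]

/-- The constant relating the spherical partial integral to `besselKernel`. -/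
noncomputable def sphericalConst (k : ℕ) : ℂ :=
  ((1 / (2 * Real.pi) ^ (2 * k + 1) : ℝ) : ℂ) *
    ((volume.real (Metric.ball (0 : EuclideanSpace ℝ (Fin (2 * k))) 1) : ℝ) : ℂ)

theorem sphericalPartialIntegral_eq (k : ℕ) {F : EuclideanSpace ℝ (Fin (2 * k + 1)) → X}
    (hF : Integrable F) {R : ℝ} (hR : 0 ≤ R) (x : EuclideanSpace ℝ (Fin (2 * k + 1))) :
    sphericalPartialIntegral F R x =
      sphericalConst k • ∫ y, besselKernel k R ‖y‖ • F (x + y) := by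
  set B := Metric.closedBall (0 : EuclideanSpace ℝ (Fin (2 * k + 1))) R
  have hmul : ∀ ξ s : EuclideanSpace ℝ (Fin (2 * k + 1)),
      Complex.exp (Complex.I * ((inner ℝ x ξ : ℝ) : ℂ)) *
        Complex.exp (-Complex.I * ((inner ℝ ξ s : ℝ) : ℂ)) =
      Complex.exp (Complex.I * ((inner ℝ (x - s) ξ : ℝ) : ℂ)) := by
    intro ξ s
    rw [← Complex.exp_add, inner_sub_left, real_inner_comm s ξ]
    congr 1
    push_cast
    ring
  have h1 : ∀ ξ, Complex.exp (Complex.I * ((inner ℝ x ξ : ℝ) : ℂ)) • fourierHat F ξ =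
      ∫ s, Complex.exp (Complex.I * ((inner ℝ (x - s) ξ : ℝ) : ℂ)) • F s := by
    intro ξ
    rw [fourierHat, ← integral_smul]
    simp only [smul_smul, hmul]
  have hint : Integrable (Function.uncurry fun ξ s : EuclideanSpace ℝ (Fin (2 * k + 1)) =>
      Complex.exp (Complex.I * ((inner ℝ (x - s) ξ : ℝ) : ℂ)) • F s)
      ((volume.restrict B).prod volume) := by
    have : IsFiniteMeasure (volume.restrict B) :=
      ⟨by simpa using (isCompact_closedBall _ _).measure_lt_top⟩
    have h := hF.comp_snd (volume.restrict B)
    refine Integrable.mono h ?_ (Eventually.of_forall fun p => ?_)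
    · refine AEStronglyMeasurable.smul (Continuous.aestronglyMeasurable ?_) h.1
      fun_prop
    · simp only [Function.uncurry, norm_smul]
      rw [mul_comm Complex.I, Complex.norm_exp_ofReal_mul_I, one_mul]
  rw [sphericalPartialIntegral]
  simp only [h1]
  rw [integral_integral_swap hint]
  have h2 : ∀ s, ∫ ξ in B, Complex.exp (Complex.I * ((inner ℝ (x - s) ξ : ℝ) : ℂ)) • F s =
      ((volume.real (Metric.ball (0 : EuclideanSpace ℝ (Fin (2 * k))) 1) : ℝ) : ℂ) •
        besselKernel k R ‖s - x‖ • F (x + (s - x)) := by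
    intro s
    rw [integral_smul_const, setIntegral_closedBall_exp_inner k hR, smul_smul, norm_sub_rev,
      add_sub_cancel]
  simp only [h2]
  rw [integral_smul, integral_sub_right_eq_self (fun y => besselKernel k R ‖y‖ • F (x + y)),
    sphericalConst, mul_smul, Complex.coe_smul, Complex.coe_smul]

end partialIntegral

/-! ### Polar coordinates for vector-valued integrals. -/

section polar

theorem homeomorphUnitSphereProd_snd_smul_fst {E : Type*} [NormedAddCommGroup E]
    [NormedSpace ℝ E] (x : ({0}ᶜ : Set E)) :
    (homeomorphUnitSphereProd E x).2.1 • (homeomorphUnitSphereProd E x).1.1 = x.1 := by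
  rw [← homeomorphUnitSphereProd_symm_apply_coe, Homeomorph.symm_apply_apply]

variable {E : Type*} [NormedAddCommGroup E] [NormedSpace ℝ E] [FiniteDimensional ℝ E]
  [MeasurableSpace E] [BorelSpace E] (μ : Measure E) [μ.IsAddHaarMeasure]
  {X : Type*} [NormedAddCommGroup X]

theorem integrable_volumeIoiPow_iff [NormedSpace ℝ X] (n : ℕ) {f : ℝ → X} :
    Integrable (fun r : Set.Ioi (0 : ℝ) => f r) (Measure.volumeIoiPow n) ↔
      IntegrableOn (fun r : ℝ => r ^ n • f r) (Set.Ioi 0) := by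
  rw [integrableOn_iff_comap_subtypeVal measurableSet_Ioi, Function.comp_def,
    Measure.volumeIoiPow, integrable_withDensity_iff_integrable_smul', integrable_congr]
  · refine .of_forall ?_
    rintro ⟨x, hx : 0 < x⟩
    simp (disch := positivity) [ENNReal.toReal_ofReal]
  · fun_prop
  · simp

theorem integral_volumeIoiPow [NormedSpace ℝ X] (n : ℕ) (f : ℝ → X) :
    ∫ r : Set.Ioi (0 : ℝ), f r ∂(Measure.volumeIoiPow n) =
      ∫ r in Set.Ioi (0 : ℝ), r ^ n • f r := by
  simp only [Measure.volumeIoiPow, ENNReal.ofReal]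
  rw [integral_withDensity_eq_integral_smul,
    integral_subtype_comap measurableSet_Ioi fun a => Real.toNNReal (a ^ n) • f a,
    setIntegral_congr_fun measurableSet_Ioi fun x hx => ?_]
  · rw [NNReal.smul_def, Real.coe_toNNReal _ (pow_nonneg hx.out.le _)]
  · exact (measurable_subtype_coe.pow_const _).real_toNNReal

theorem MeasureTheory.Integrable.comp_polar {h : E → X} (hh : Integrable h μ) :
    Integrable (fun p : Metric.sphere (0 : E) 1 × Set.Ioi (0 : ℝ) => h (p.2.1 • p.1.1))
      (μ.toSphere.prod (Measure.volumeIoiPow (Module.finrank ℝ E - 1))) := by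
  rw [← μ.measurePreserving_homeomorphUnitSphereProd.integrable_comp_emb
    (Homeomorph.measurableEmbedding _), Function.comp_def]
  simp only [homeomorphUnitSphereProd_snd_smul_fst]
  have := hh.integrableOn (s := {0}ᶜ)
  rwa [integrableOn_iff_comap_subtypeVal (by measurability)] at this

variable [NormedSpace ℝ X]

theorem MeasureTheory.Integrable.ae_integrableOn_ray {h : E → X} (hh : Integrable h μ) :
    ∀ᵐ ω ∂μ.toSphere, IntegrableOn
      (fun r : ℝ => r ^ (Module.finrank ℝ E - 1) • h (r • ω.1)) (Set.Ioi 0) := by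
  filter_upwards [(hh.comp_polar μ).prod_right_ae] with ω hω
  exact (integrable_volumeIoiPow_iff _ (f := fun r => h (r • ω.1))).1 hω

theorem integral_eq_integral_ray [Nontrivial E] {h : E → X} (hh : Integrable h μ) :
    ∫ y, h y ∂μ = ∫ ω : Metric.sphere (0 : E) 1, (∫ r in Set.Ioi (0 : ℝ),
      r ^ (Module.finrank ℝ E - 1) • h (r • ω.1)) ∂μ.toSphere := by
  have h1 := μ.measurePreserving_homeomorphUnitSphereProd.integral_comp
    (Homeomorph.measurableEmbedding _)
    (fun p : Metric.sphere (0 : E) 1 × Set.Ioi (0 : ℝ) => h (p.2.1 • p.1.1))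
  simp only [homeomorphUnitSphereProd_snd_smul_fst] at h1
  rw [integral_subtype_comap (measurableSet_singleton _).compl h,
    restrict_compl_singleton] at h1
  rw [h1, integral_prod _ (hh.comp_polar μ)]
  congr 1
  funext ω
  exact integral_volumeIoiPow _ (fun r => h (r • ω.1))

theorem MeasureTheory.Integrable.integrable_integral_ray {h : E → X} (hh : Integrable h μ) :
    Integrable (fun ω : Metric.sphere (0 : E) 1 => ∫ r in Set.Ioi (0 : ℝ),
      r ^ (Module.finrank ℝ E - 1) • h (r • ω.1)) μ.toSphere := by
  have := (hh.comp_polar μ).integral_prod_left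
  refine this.congr (Eventually.of_forall fun ω => ?_)
  exact integral_volumeIoiPow _ (fun r => h (r • ω.1))

end polar

/-! ### The Riemann-Lebesgue lemma with radial phase. -/

section riemannLebesgue

variable {X : Type*} [NormedAddCommGroup X] [NormedSpace ℂ X]

/-- Integrability of `f` is not needed: otherwise all the integrals are `0` by convention. -/
theorem tendsto_integral_exp_mul_smul {ι : Type*} {l : Filter ι} {u : ι → ℝ}
    (hu : Tendsto u l (cocompact ℝ)) (f : ℝ → X) :
    Tendsto (fun i => ∫ r, Complex.exp (Complex.I * ((u i * r : ℝ) : ℂ)) • f r) l (nhds 0) := by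
  have hc : (-(2 * Real.pi)⁻¹ : ℝ) ≠ 0 := by
    have := Real.pi_pos
    simp [this.ne']
  have h1 : Tendsto (fun w : ℝ => w * (-(2 * Real.pi)⁻¹)) (cocompact ℝ) (cocompact ℝ) :=
    (Homeomorph.mulRight₀ _ hc).isClosedEmbedding.tendsto_cocompact
  refine ((Real.tendsto_integral_exp_smul_cocompact f).comp (h1.comp hu)).congr fun i => ?_
  simp only [Function.comp_def]
  congr 1
  funext r
  rw [Circle.smul_def, Real.fourierChar_apply]
  congr 2
  push_cast
  have : (Real.pi : ℂ) ≠ 0 := by exact_mod_cast Real.pi_ne_zero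
  field_simp

theorem MeasureTheory.Integrable.exp_norm_smul {E : Type*} [NormedAddCommGroup E]
    [MeasurableSpace E] [BorelSpace E] (μ : Measure E) [SecondCountableTopology E] {W : E → X}
    (hW : Integrable W μ) (u : ℝ) :
    Integrable (fun y => Complex.exp (Complex.I * ((u * ‖y‖ : ℝ) : ℂ)) • W y) μ := by
  refine hW.mono ?_ (Eventually.of_forall fun y => ?_)
  · exact (Continuous.aestronglyMeasurable (by fun_prop)).smul hW.1
  · rw [norm_smul, mul_comm Complex.I, Complex.norm_exp_ofReal_mul_I, one_mul]

variable {E : Type*} [NormedAddCommGroup E] [NormedSpace ℝ E] [FiniteDimensional ℝ E]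
  [MeasurableSpace E] [BorelSpace E] [Nontrivial E] (μ : Measure E) [μ.IsAddHaarMeasure]

/-- On each ray the phase is linear and the one-dimensional lemma applies; dominated convergence
over the sphere finishes. -/
theorem tendsto_integral_exp_norm_smul {ι : Type*} {l : Filter ι} [l.IsCountablyGenerated]
    {u : ι → ℝ} (hu : Tendsto u l (cocompact ℝ)) {W : E → X} (hW : Integrable W μ) :
    Tendsto (fun i => ∫ y, Complex.exp (Complex.I * ((u i * ‖y‖ : ℝ) : ℂ)) • W y ∂μ)
      l (nhds 0) := by
  simp only [fun i => integral_eq_integral_ray μ (hW.exp_norm_smul μ (u i))]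
  have h0 : ∫ _ : Metric.sphere (0 : E) 1, (0 : X) ∂μ.toSphere = 0 := by simp
  rw [← h0]
  refine tendsto_integral_filter_of_dominated_convergence
    (fun ω => ∫ r in Set.Ioi (0 : ℝ), r ^ (Module.finrank ℝ E - 1) • ‖W (r • ω.1)‖)
    (Eventually.of_forall fun i => ((hW.exp_norm_smul μ (u i)).integrable_integral_ray μ).1)
    (Eventually.of_forall fun i => Eventually.of_forall fun ω => ?_)
    (hW.norm.integrable_integral_ray μ)
    (Eventually.of_forall fun ω => ?_)
  · refine (norm_integral_le_integral_norm _).trans_eq ?_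
    refine setIntegral_congr_fun measurableSet_Ioi fun r hr => ?_
    have hr : (0 : ℝ) < r := hr
    simp only [norm_smul, norm_pow, Real.norm_of_nonneg hr.le, smul_eq_mul]
    rw [mul_comm Complex.I, Complex.norm_exp_ofReal_mul_I, one_mul]
  · have h1 := tendsto_integral_exp_mul_smul hu
      ((Set.Ioi (0 : ℝ)).indicator fun r => r ^ (Module.finrank ℝ E - 1) • W (r • ω.1))
    refine h1.congr fun i => ?_
    rw [← integral_indicator measurableSet_Ioi]
    congr 1
    funext r
    by_cases hr : r ∈ Set.Ioi (0 : ℝ)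
    · have hr' : (0 : ℝ) < r := hr
      rw [Set.indicator_of_mem hr, Set.indicator_of_mem hr, smul_comm]
      have : ‖r • ω.1‖ = r := by
        rw [norm_smul, Real.norm_of_nonneg hr'.le, mem_sphere_zero_iff_norm.1 ω.2, mul_one]
      rw [this]
    · rw [Set.indicator_of_notMem hr, Set.indicator_of_notMem hr, smul_zero]

end riemannLebesgue

/-! ### The function with its value at the base point removed. -/

section bumpDefect

variable {E X : Type*} [NormedAddCommGroup E] [NormedSpace ℝ E]
  [NormedAddCommGroup X] [NormedSpace ℝ X]

/-- The `i`-th derivative at `y` in direction `v` of `y ↦ F (x + y) - b y • F x`. -/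
noncomputable def bumpDefect (b : E → ℝ) (F : E → X) (i : ℕ) (x y v : E) : X :=
  iteratedFDeriv ℝ i F (x + y) (fun _ => v) - iteratedFDeriv ℝ i b y (fun _ => v) • F x

theorem hasDerivAt_iteratedFDeriv_line {G : E → X} {i : ℕ} (hG : ContDiff ℝ (i + 1 : ℕ) G)
    (x v : E) (r : ℝ) :
    HasDerivAt (fun r : ℝ => iteratedFDeriv ℝ i G (x + r • v) (fun _ => v))
      (iteratedFDeriv ℝ (i + 1) G (x + r • v) (fun _ => v)) r := by
  have hd : Differentiable ℝ (iteratedFDeriv ℝ i G) :=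
    hG.differentiable_iteratedFDeriv (by exact_mod_cast Nat.lt_succ_self i)
  have hl : HasDerivAt (fun r : ℝ => x + r • v) v r := by
    simpa using ((hasDerivAt_id r).smul_const v).const_add x
  have h := (hd (x + r • v)).hasFDerivAt.comp_hasDerivAt r hl
  have h2 := (ContinuousMultilinearMap.apply ℝ (fun _ : Fin i => E) X
    (fun _ => v)).hasFDerivAt.comp_hasDerivAt r h
  exact h2

theorem continuous_iteratedFDeriv_apply_diag {G : E → X} {i : ℕ} (hG : ContDiff ℝ i G) :
    Continuous fun p : E × E => iteratedFDeriv ℝ i G p.1 (fun _ => p.2) := by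
  have h := (hG.continuous_iteratedFDeriv le_rfl).comp (continuous_fst (X := E) (Y := E))
  exact h.eval (continuous_pi fun _ => continuous_snd)

theorem iteratedFDeriv_apply_diag_smul (i : ℕ) (G : E → X) (z v : E) (r : ℝ) :
    iteratedFDeriv ℝ i G z (fun _ => r • v) = r ^ i • iteratedFDeriv ℝ i G z (fun _ => v) := by
  simpa using (iteratedFDeriv ℝ i G z).map_smul_univ (fun _ => r) (fun _ => v)

variable {b : E → ℝ} {F : E → X}

theorem bumpDefect_zero (x y v : E) : bumpDefect b F 0 x y v = F (x + y) - b y • F x := by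
  simp [bumpDefect]

theorem bumpDefect_smul (i : ℕ) (x y v : E) (r : ℝ) :
    bumpDefect b F i x y (r • v) = r ^ i • bumpDefect b F i x y v := by
  rw [bumpDefect, bumpDefect, iteratedFDeriv_apply_diag_smul, iteratedFDeriv_apply_diag_smul,
    smul_assoc, smul_sub]

theorem hasDerivAt_bumpDefect {i : ℕ} (hb : ContDiff ℝ (i + 1 : ℕ) b)
    (hF : ContDiff ℝ (i + 1 : ℕ) F) (x v : E) (r : ℝ) :
    HasDerivAt (fun r : ℝ => bumpDefect b F i x (r • v) v)
      (bumpDefect b F (i + 1) x (r • v) v) r := by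
  have h1 := hasDerivAt_iteratedFDeriv_line hF x v r
  have h2 := hasDerivAt_iteratedFDeriv_line hb 0 v r
  simp only [zero_add] at h2
  exact h1.sub (h2.smul_const (F x))

theorem continuous_bumpDefect {i : ℕ} (hb : ContDiff ℝ i b) (hF : ContDiff ℝ i F) :
    Continuous fun p : E × E × E => bumpDefect b F i p.1 p.2.1 p.2.2 := by
  have h1 := (continuous_iteratedFDeriv_apply_diag hF).comp
    (f := fun p : E × E × E => (p.1 + p.2.1, p.2.2)) (by fun_prop)
  have h2 := (continuous_iteratedFDeriv_apply_diag hb).comp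
    (f := fun p : E × E × E => (p.2.1, p.2.2)) (by fun_prop)
  exact h1.sub (h2.smul (hF.continuous.comp continuous_fst))

theorem continuous_bumpDefect_diag {i : ℕ} (hb : ContDiff ℝ i b) (hF : ContDiff ℝ i F) (x : E) :
    Continuous fun y => bumpDefect b F i x y y :=
  (continuous_bumpDefect hb hF).comp (f := fun y : E => (x, y, y)) (by fun_prop)

theorem bumpDefect_of_notMem_tsupport {i : ℕ} {x y : E} (hy : y ∉ tsupport b) (v : E) :
    bumpDefect b F i x y v = iteratedFDeriv ℝ i F (x + y) (fun _ => v) := by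
  have : iteratedFDeriv ℝ i b y = 0 := by
    by_contra h
    exact hy (support_iteratedFDeriv_subset (𝕜 := ℝ) i h)
  simp [bumpDefect, this]

variable [FiniteDimensional ℝ E]

theorem exists_norm_bumpDefect_le_mul_pow {i : ℕ} (hb : ContDiff ℝ i b) (hF : ContDiff ℝ i F)
    {K : Set E} (hK : IsCompact K) (δ : ℝ) :
    ∃ M, 0 ≤ M ∧ ∀ x ∈ K, ∀ y z, ‖z‖ ≤ δ → ‖bumpDefect b F i x z y‖ ≤ M * ‖y‖ ^ i := by
  have hc := hK.prod ((isCompact_closedBall (0 : E) δ).prod (isCompact_closedBall (0 : E) 1))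
  obtain ⟨M, hM⟩ := hc.exists_bound_of_continuousOn (continuous_bumpDefect hb hF).continuousOn
  refine ⟨max M 0, le_max_right _ _, fun x hx y z hz => ?_⟩
  have hv : y = ‖y‖ • (‖y‖⁻¹ • y) := by
    by_cases h : y = 0
    · simp [h]
    · rw [smul_smul, mul_inv_cancel₀ (norm_ne_zero_iff.2 h), one_smul]
  have hv1 : ‖‖y‖⁻¹ • y‖ ≤ 1 := by
    rw [norm_smul, norm_inv, norm_norm]
    exact inv_mul_le_one
  have := hM (x, z, ‖y‖⁻¹ • y) ⟨hx, by simpa using hz, by simpa using hv1⟩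
  rw [hv, bumpDefect_smul, norm_smul, norm_pow, norm_norm, mul_comm, ← hv]
  gcongr
  exact this.trans (le_max_left _ _)

/-- For `i = 0` the defect vanishes at `y = 0` because `b 0 = 1`, and the mean value inequality
along the segment gives a factor `‖y‖`. For `i ≥ 1`, homogeneity gives `‖y‖ ^ i ≤ δ ^ (i - 1) ‖y‖`.
-/
theorem exists_norm_bumpDefect_diag_le {k i : ℕ} (hk : 1 ≤ k) (hi : i ≤ k) (hb : ContDiff ℝ k b)
    (hF : ContDiff ℝ k F) (hb0 : b 0 = 1) {K : Set E} (hK : IsCompact K) {δ : ℝ} (hδ : 0 ≤ δ) :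
    ∃ M, 0 ≤ M ∧ ∀ x ∈ K, ∀ y, ‖y‖ ≤ δ → ‖bumpDefect b F i x y y‖ ≤ M * ‖y‖ := by
  have hle : ∀ {j : ℕ}, j ≤ k → (j : WithTop ℕ∞) ≤ k := fun h => by exact_mod_cast h
  rcases Nat.eq_zero_or_pos i with rfl | hi0
  · obtain ⟨M, hM0, hM⟩ := exists_norm_bumpDefect_le_mul_pow (i := 1) (hb.of_le (hle hk))
      (hF.of_le (hle hk)) hK δ
    refine ⟨M, hM0, fun x hx y hy => ?_⟩
    have h := norm_image_sub_le_of_norm_deriv_le_segment_01'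
      (f := fun r : ℝ => bumpDefect b F 0 x (r • y) y)
      (f' := fun r : ℝ => bumpDefect b F 1 x (r • y) y) (C := M * ‖y‖)
      (fun r _ => (hasDerivAt_bumpDefect (hb.of_le (hle hk)) (hF.of_le (hle hk))
        x y r).hasDerivWithinAt) (fun r hr => ?_)
    · simpa [bumpDefect_zero, hb0] using h
    · refine (hM x hx y (r • y) ?_).trans_eq (by rw [pow_one])
      rw [norm_smul, Real.norm_of_nonneg hr.1]
      nlinarith [hr.2, norm_nonneg y]
  · obtain ⟨M, hM0, hM⟩ := exists_norm_bumpDefect_le_mul_pow (i := i) (hb.of_le (hle hi))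
      (hF.of_le (hle hi)) hK δ
    refine ⟨M * δ ^ (i - 1), by positivity, fun x hx y hy => (hM x hx y y hy).trans ?_⟩
    obtain ⟨j, rfl⟩ := Nat.exists_eq_succ_of_ne_zero hi0.ne'
    rw [pow_succ, mul_assoc]
    simp only [Nat.succ_eq_add_one, Nat.add_sub_cancel]
    gcongr

end bumpDefect

/-! ### Integrability and `L¹` continuity of the densities. -/

section radialDensity

variable {E X : Type*} [NormedAddCommGroup E] [NormedSpace ℝ E] [FiniteDimensional ℝ E]
  [MeasurableSpace E] [BorelSpace E] [NormedAddCommGroup X] [NormedSpace ℝ X]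
  {b : E → ℝ} {F : E → X}

variable (b F) in
/-- The density `‖y‖⁻ⁿ Dⁱ(F(x + ·) - b • F x)(y)(y, …, y)`, where `n` is the dimension. -/
noncomputable def radialDensity (i : ℕ) (x y : E) : X :=
  (‖y‖ ^ Module.finrank ℝ E)⁻¹ • bumpDefect b F i x y y

variable (b F) in
/-- On `K`, the radial derivatives of order at most `k` of `F(x + ·) - b • F x` are dominated
outside the ball of radius `δ` by an integrable weight. -/
structure FarBound (k : ℕ) (K : Set E) (δ : ℝ) (g : E → ℝ) : Prop where
  one_le : 1 ≤ δ
  bound : ∀ y, δ ≤ ‖y‖ → ∀ x ∈ K, ∀ i ≤ k, ‖y‖ ^ (k - i) * ‖bumpDefect b F i x y y‖ ≤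
    ‖y‖ ^ Module.finrank ℝ E * g y

variable {μ : Measure E}

theorem aestronglyMeasurable_radialDensity {i : ℕ} (hb : ContDiff ℝ i b) (hF : ContDiff ℝ i F)
    (x : E) : AEStronglyMeasurable (radialDensity b F i x) μ := by
  refine AEStronglyMeasurable.smul ?_ (continuous_bumpDefect_diag hb hF x).aestronglyMeasurable
  exact ((measurable_norm.pow_const _).inv).aestronglyMeasurable

variable [Nontrivial E] [μ.IsAddHaarMeasure]

theorem integrableOn_ball_norm_pow_inv (δ : ℝ) :
    IntegrableOn (fun y : E => (‖y‖ ^ (Module.finrank ℝ E - 1))⁻¹) (Metric.ball 0 δ) μ := by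
  rw [integrableOn_fun_norm_addHaar μ (f := fun r : ℝ => (r ^ (Module.finrank ℝ E - 1))⁻¹)]
  refine IntegrableOn.congr_fun (f := fun _ => (1 : ℝ)) (by simp) (fun r hr => ?_)
    measurableSet_Ioo
  have : r ^ (Module.finrank ℝ E - 1) ≠ 0 := pow_ne_zero _ hr.1.ne'
  simp [this]

/-- Near `0` the gained factor `‖y‖` leaves the integrable singularity `‖y‖^(1-n)`; far away
`FarBound` gives `g`. The majorant is common to all `x ∈ K`, as dominated convergence in `x`
requires. -/
theorem exists_integrable_norm_radialDensity_le {k i : ℕ} (hk : 1 ≤ k) (hi : i ≤ k)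
    (hb : ContDiff ℝ k b) (hF : ContDiff ℝ k F) (hb0 : b 0 = 1) {K : Set E} (hK : IsCompact K)
    {δ : ℝ} {g : E → ℝ} (hg : Integrable g μ) (hfar : FarBound b F k K δ g) :
    ∃ H : E → ℝ, Integrable H μ ∧ ∀ x ∈ K, ∀ y, ‖radialDensity b F i x y‖ ≤ H y := by
  have hδ := hfar.one_le
  obtain ⟨M, hM0, hM⟩ := exists_norm_bumpDefect_diag_le hk hi hb hF hb0 hK (δ := δ) (by linarith)
  refine ⟨fun y => (Metric.ball 0 δ).indicator
    (fun y => M * (‖y‖ ^ (Module.finrank ℝ E - 1))⁻¹) y + |g y|,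
    (IntegrableOn.integrable_indicator ((integrableOn_ball_norm_pow_inv δ).const_mul M)
      measurableSet_ball).add hg.abs, fun x hx y => ?_⟩
  rw [radialDensity, norm_smul, norm_inv, norm_pow, norm_norm]
  beta_reduce
  by_cases hy : ‖y‖ < δ
  · rw [Set.indicator_of_mem (by simpa using hy)]
    refine le_add_of_le_of_nonneg ?_ (abs_nonneg _)
    rcases eq_or_ne y 0 with rfl | hy0
    · have : Module.finrank ℝ E ≠ 0 := Module.finrank_pos.ne'
      simp only [norm_zero, zero_pow this, inv_zero, zero_mul]
      positivity
    · have hn : Module.finrank ℝ E = Module.finrank ℝ E - 1 + 1 :=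
        (Nat.sub_add_cancel Module.finrank_pos).symm
      have hy1 : 0 < ‖y‖ := norm_pos_iff.2 hy0
      calc _ ≤ (‖y‖ ^ Module.finrank ℝ E)⁻¹ * (M * ‖y‖) := by
            gcongr
            exact hM x hx y hy.le
        _ = _ := by
            conv_lhs => rw [hn, pow_succ]
            field_simp
  · rw [Set.indicator_of_notMem (by simpa using hy), zero_add]
    have hy : δ ≤ ‖y‖ := not_lt.1 hy
    have hy1 : 1 ≤ ‖y‖ := hδ.trans hy
    refine le_trans ?_ (le_abs_self _)
    rw [inv_mul_le_iff₀ (by positivity)]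
    refine le_trans ?_ (hfar.bound y hy x hx i hi)
    exact le_mul_of_one_le_left (norm_nonneg _) (one_le_pow₀ hy1)

theorem tendsto_integral_norm_radialDensity_sub {k i : ℕ} (hk : 1 ≤ k) (hi : i ≤ k)
    (hb : ContDiff ℝ k b) (hF : ContDiff ℝ k F) (hb0 : b 0 = 1) {K : Set E} (hK : IsCompact K)
    {δ : ℝ} {g : E → ℝ} (hg : Integrable g μ) (hfar : FarBound b F k K δ g) {x₀ : E}
    (hx₀ : K ∈ nhds x₀) :
    Tendsto (fun x => ∫ y, ‖radialDensity b F i x y - radialDensity b F i x₀ y‖ ∂μ)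
      (nhds x₀) (nhds 0) := by
  have hle : (i : WithTop ℕ∞) ≤ k := by exact_mod_cast hi
  have hbi := hb.of_le hle
  have hFi := hF.of_le hle
  obtain ⟨H, hH, hbd⟩ := exists_integrable_norm_radialDensity_le hk hi hb hF hb0 hK hg hfar
  have h0 : ∫ _ : E, (0 : ℝ) ∂μ = 0 := by simp
  rw [← h0]
  refine tendsto_integral_filter_of_dominated_convergence (fun y => H y + H y)
    (Eventually.of_forall fun x => ((aestronglyMeasurable_radialDensity hbi hFi x).sub
      (aestronglyMeasurable_radialDensity hbi hFi x₀)).norm) ?_ (hH.add hH)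
    (Eventually.of_forall fun y => ?_)
  · filter_upwards [hx₀] with x hx
    refine Eventually.of_forall fun y => ?_
    rw [norm_norm]
    exact (norm_sub_le _ _).trans (add_le_add (hbd x hx y) (hbd x₀ (mem_of_mem_nhds hx₀) y))
  · have hc : Continuous fun x => radialDensity b F i x y :=
      ((continuous_bumpDefect hbi hFi).comp
        (f := fun x : E => (x, y, y)) (by fun_prop)).const_smul _
    have := ((hc.sub (continuous_const (y := radialDensity b F i x₀ y))).norm).tendsto x₀
    simpa using this

end radialDensity

/-! ### Riemann-Lebesgue jointly in the frequency and the parameter. -/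

section oscillation

variable {E X : Type*} [NormedAddCommGroup E] [NormedSpace ℝ E] [FiniteDimensional ℝ E]
  [MeasurableSpace E] [BorelSpace E] [Nontrivial E] [NormedAddCommGroup X] [NormedSpace ℂ X]
  (μ : Measure E) [μ.IsAddHaarMeasure]

/-- Splitting `W x = W x₀ + (W x - W x₀)`, the second part is bounded by an `L¹` norm independent of
the frequency. -/
theorem tendsto_integral_exp_norm_smul_family {W : E → E → X} {x₀ : E}
    (hW : ∀ᶠ x in nhds x₀, Integrable (W x) μ)
    (hcont : Tendsto (fun x => ∫ y, ‖W x y - W x₀ y‖ ∂μ) (nhds x₀) (nhds 0))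
    {u : ℝ → ℝ} (hu : Tendsto u atTop (cocompact ℝ)) :
    Tendsto (fun p : ℝ × E => ∫ y, Complex.exp (Complex.I * ((u p.1 * ‖y‖ : ℝ) : ℂ)) • W p.2 y ∂μ)
      (atTop ×ˢ nhds x₀) (nhds 0) := by
  have h1 := (tendsto_integral_exp_norm_smul μ hu hW.self_of_nhds).norm.comp
    (tendsto_fst (f := atTop) (g := nhds x₀))
  have h2 := hcont.comp (tendsto_snd (f := (atTop : Filter ℝ)) (g := nhds x₀))
  have h3 := h1.add h2
  simp only [norm_zero, add_zero] at h3
  refine squeeze_zero_norm' ?_ h3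
  filter_upwards [tendsto_snd.eventually hW] with p hp
  have e : ∫ y, Complex.exp (Complex.I * ((u p.1 * ‖y‖ : ℝ) : ℂ)) • W p.2 y ∂μ =
      (∫ y, Complex.exp (Complex.I * ((u p.1 * ‖y‖ : ℝ) : ℂ)) • W x₀ y ∂μ) +
        ∫ y, Complex.exp (Complex.I * ((u p.1 * ‖y‖ : ℝ) : ℂ)) • (W p.2 y - W x₀ y) ∂μ := by
    rw [← integral_add (hW.self_of_nhds.exp_norm_smul μ _)
      (Integrable.exp_norm_smul μ (W := fun y => W p.2 y - W x₀ y) (hp.sub hW.self_of_nhds) _)]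
    congr 1
    funext y
    rw [← smul_add, add_sub_cancel]
  rw [e]
  refine (norm_add_le _ _).trans
    (add_le_add le_rfl ((norm_integral_le_integral_norm _).trans_eq ?_))
  simp only [Function.comp_def]
  congr 1
  funext y
  rw [norm_smul, mul_comm Complex.I, Complex.norm_exp_ofReal_mul_I, one_mul]

end oscillation

/-! ### Reduction of the kernel integral to oscillatory integrals. -/

section reduction

variable {X : Type*} [NormedAddCommGroup X] [NormedSpace ℂ X]

theorem MeasureTheory.Integrable.besselKernel_norm_smul {E : Type*} [NormedAddCommGroup E]
    [MeasurableSpace E] [BorelSpace E] {μ : Measure E} {f : E → X} (hf : Integrable f μ)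
    (m : ℕ) (R : ℝ) : Integrable (fun y => besselKernel m R ‖y‖ • f y) μ := by
  obtain ⟨C, hC⟩ := exists_norm_besselKernel_le m R
  have hm : AEStronglyMeasurable (fun y : E => besselKernel m R ‖y‖) μ :=
    ((continuous_besselKernel m R).measurable.comp measurable_norm).aestronglyMeasurable
  exact Integrable.bdd_smul hf C hm (Eventually.of_forall fun y => hC _)

theorem FarBound.ae_integrableOn_ray {E : Type*} [NormedAddCommGroup E] [NormedSpace ℝ E]
    [FiniteDimensional ℝ E] [MeasurableSpace E] [BorelSpace E] [Nontrivial E]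
    {μ : Measure E} [μ.IsAddHaarMeasure] {b : E → ℝ} {F : E → X} {k : ℕ} {K : Set E} {δ : ℝ}
    {g : E → ℝ} (hfar : FarBound b F (k + 1) K δ g) (hg : Integrable g μ)
    (hb : ContDiff ℝ (k + 1 : ℕ) b) (hF : ContDiff ℝ (k + 1 : ℕ) F) {x : E} (hx : x ∈ K) {i : ℕ}
    (hi : i ≤ k + 1) :
    ∀ᵐ ω ∂μ.toSphere, IntegrableOn (fun r : ℝ => r ^ k • bumpDefect b F i x (r • ω.1) ω.1)
      (Set.Ioi δ) := by
  have hδ := hfar.one_le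
  have hle : (i : WithTop ℕ∞) ≤ (k + 1 : ℕ) := by exact_mod_cast hi
  have hms : MeasurableSet {y : E | δ ≤ ‖y‖} := measurableSet_le measurable_const measurable_norm
  have hV : Integrable ({y : E | δ ≤ ‖y‖}.indicator fun y =>
      (‖y‖ ^ (k + 1 - i)) • radialDensity b F i x y) μ := by
    rw [integrable_indicator_iff hms]
    refine Integrable.mono' hg.norm.integrableOn ?_ ?_
    · have hc : Continuous fun y : E => ‖y‖ ^ (k + 1 - i) := by fun_prop
      exact hc.aestronglyMeasurable.smul
        (aestronglyMeasurable_radialDensity (hb.of_le hle) (hF.of_le hle) x)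
    · filter_upwards [ae_restrict_mem hms] with y hy
      have hy : δ ≤ ‖y‖ := hy
      have hy1 : 0 < ‖y‖ := by linarith
      refine le_trans ?_ (le_abs_self (g y))
      rw [radialDensity, norm_smul, norm_smul, norm_inv, norm_pow, norm_pow, norm_norm,
        mul_left_comm, inv_mul_le_iff₀ (by positivity)]
      exact hfar.bound y hy x hx i hi
  filter_upwards [hV.ae_integrableOn_ray μ] with ω hω
  refine IntegrableOn.congr_fun
    (hω.mono_set (Set.Ioi_subset_Ioi (zero_le_one.trans hδ))) (fun r hr => ?_) measurableSet_Ioi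
  have hr : δ < r := hr
  have hr0 : 0 < r := by linarith
  have hn : ‖r • ω.1‖ = r := by
    rw [norm_smul, Real.norm_of_nonneg hr0.le, mem_sphere_zero_iff_norm.1 ω.2, mul_one]
  have hmem : r • ω.1 ∈ {y : E | δ ≤ ‖y‖} := by
    change δ ≤ ‖r • ω.1‖
    rw [hn]; exact hr.le
  have hd : Module.finrank ℝ E = Module.finrank ℝ E - 1 + 1 :=
    (Nat.sub_add_cancel Module.finrank_pos).symm
  rw [Set.indicator_of_mem hmem, hn, radialDensity, bumpDefect_smul, hn, smul_smul, smul_smul,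
    smul_smul]
  congr 1
  conv_lhs => rw [hd]
  simp only [Nat.add_sub_cancel]
  have e : r ^ (k + 1 - i) * r ^ i = r ^ k * r := by
    rw [← pow_add, Nat.sub_add_cancel hi, pow_succ]
  rw [pow_succ]
  field_simp
  linear_combination e

/-- The Jacobian `r^(n-1) = r^(2(k+1))` is precisely the power needed to run the ray formula with `m
= k + 1`, `j = 0`. Afterwards `r^i K_0` times the directional derivative is rewritten as the
Jacobian times a density with phases `e^{±iRr}`, and the ray integrals are reassembled. -/
theorem exists_integral_besselKernel_bumpDefect (X : Type*) [NormedAddCommGroup X]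
    [NormedSpace ℂ X] [CompleteSpace X] (k : ℕ) : ∃ c : ℕ → ℂ,
    ∀ (b : EuclideanSpace ℝ (Fin (2 * (k + 1) + 1)) → ℝ)
      (F : EuclideanSpace ℝ (Fin (2 * (k + 1) + 1)) → X)
      (K : Set (EuclideanSpace ℝ (Fin (2 * (k + 1) + 1)))) (δ : ℝ)
      (g : EuclideanSpace ℝ (Fin (2 * (k + 1) + 1)) → ℝ),
      IsCompact K → ContDiff ℝ (k + 1 : ℕ) b → ContDiff ℝ (k + 1 : ℕ) F → b 0 = 1 →
      Integrable b → Integrable F → Integrable g → FarBound b F (k + 1) K δ g →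
      ∀ x ∈ K, ∀ R : ℝ,
        ∫ y, besselKernel (k + 1) R ‖y‖ • (F (x + y) - b y • F x) =
          ∑ i ∈ Finset.range (k + 2), c i •
            ((∫ y, Complex.exp (Complex.I * ((R * ‖y‖ : ℝ) : ℂ)) • radialDensity b F i x y) -
              ∫ y, Complex.exp (Complex.I * ((-R * ‖y‖ : ℝ) : ℂ)) • radialDensity b F i x y) := by
  obtain ⟨c, hc⟩ := exists_integral_besselKernel_eq_sum X k (k + 1) 0 (by omega)
  refine ⟨fun i => c i * Complex.I⁻¹, fun b F K δ g hK hb hF hb0 hbi hFi hg hfar x hx R => ?_⟩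
  have hle : ∀ {i : ℕ}, i ≤ k + 1 → (i : WithTop ℕ∞) ≤ (k + 1 : ℕ) := fun h => by exact_mod_cast h
  have hint : Integrable fun y => besselKernel (k + 1) R ‖y‖ • (F (x + y) - b y • F x) := by
    exact ((hFi.comp_add_left x).sub (hbi.smul_const (F x))).besselKernel_norm_smul (k + 1) R
  have hW : ∀ i ≤ k + 1, Integrable (radialDensity b F i x) := by
    intro i hi
    obtain ⟨H, hH, hbd⟩ := exists_integrable_norm_radialDensity_le (by omega) hi hb hF hb0 hK hg
      hfar
    exact hH.mono' (aestronglyMeasurable_radialDensity (hb.of_le (hle hi)) (hF.of_le (hle hi)) x)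
      (Eventually.of_forall (hbd x hx))
  set Z : ℕ → EuclideanSpace ℝ (Fin (2 * (k + 1) + 1)) → X := fun i y =>
    Complex.I⁻¹ • (Complex.exp (Complex.I * ((R * ‖y‖ : ℝ) : ℂ)) • radialDensity b F i x y -
      Complex.exp (Complex.I * ((-R * ‖y‖ : ℝ) : ℂ)) • radialDensity b F i x y) with hZ
  have hZi : ∀ i ≤ k + 1, Integrable (Z i) := fun i hi =>
    (((hW i hi).exp_norm_smul _ R).sub ((hW i hi).exp_norm_smul _ (-R))).smul _
  have hrhs : ∀ i ∈ Finset.range (k + 2), (c i * Complex.I⁻¹) •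
      ((∫ y, Complex.exp (Complex.I * ((R * ‖y‖ : ℝ) : ℂ)) • radialDensity b F i x y) -
        ∫ y, Complex.exp (Complex.I * ((-R * ‖y‖ : ℝ) : ℂ)) • radialDensity b F i x y) =
      ∫ ω, (c i • ∫ r in Set.Ioi (0 : ℝ), r ^ (2 * (k + 1)) • Z i (r • ω.1)) ∂volume.toSphere := by
    intro i hi
    have hi : i ≤ k + 1 := by have := Finset.mem_range.1 hi; omega
    have h := integral_eq_integral_ray volume (hZi i hi)
    rw [finrank_euclideanSpace_fin, Nat.add_sub_cancel] at h
    rw [integral_smul, ← h, hZ]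
    simp only
    rw [integral_smul, integral_sub ((hW i hi).exp_norm_smul _ R)
      ((hW i hi).exp_norm_smul _ (-R)), smul_smul]
  rw [Finset.sum_congr rfl hrhs, ← integral_finsetSum, integral_eq_integral_ray volume hint]
  · rw [finrank_euclideanSpace_fin, Nat.add_sub_cancel]
    refine integral_congr_ae ?_
    have hray : ∀ᵐ ω ∂(volume : Measure (EuclideanSpace ℝ (Fin (2 * (k + 1) + 1)))).toSphere,
        ∀ i ≤ k + 1, IntegrableOn (fun r : ℝ => r ^ k • bumpDefect b F i x (r • ω.1) ω.1)
          (Set.Ioi δ) := by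
      rw [ae_all_iff]
      intro i
      by_cases hi : i ≤ k + 1
      · filter_upwards [hfar.ae_integrableOn_ray hg hb hF hx hi] with ω h _ using h
      · exact Eventually.of_forall fun ω h => absurd h hi
    filter_upwards [hray] with ω hω
    have hn : ∀ r : ℝ, 0 < r → ‖r • ω.1‖ = r := fun r hr => by
      rw [norm_smul, Real.norm_of_nonneg hr.le, mem_sphere_zero_iff_norm.1 ω.2, mul_one]
    have h := hc R δ hfar.one_le (fun i r => bumpDefect b F i x (r • ω.1) ω.1)
      (fun i hi r => hasDerivAt_bumpDefect (hb.of_le (hle (by omega))) (hF.of_le (hle (by omega)))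
        x ω.1 r)
      (fun i hi => (continuous_bumpDefect (hb.of_le (hle hi)) (hF.of_le (hle hi))).comp
        (f := fun r : ℝ => (x, r • ω.1, ω.1)) (by fun_prop)) hω
    refine Eq.trans (setIntegral_congr_fun measurableSet_Ioi fun r hr => ?_) (h.trans
      (Finset.sum_congr rfl fun i hi => congrArg _
        (setIntegral_congr_fun measurableSet_Ioi fun r hr => ?_)))
    · have hr : (0 : ℝ) < r := hr
      simp only [bumpDefect_zero, hn r hr, add_zero]
      generalize F (x + r • ω.1) - b (r • ω.1) • F x = v
      rw [mul_comm (besselKernel _ _ _), mul_smul, ← Complex.ofReal_pow, Complex.coe_smul]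
    · have hr : (0 : ℝ) < r := hr
      simp only [hZ, radialDensity, bumpDefect_smul, hn r hr, zero_add, ← sub_smul,
        finrank_euclideanSpace_fin]
      rw [besselKernel_zero hr.ne']
      simp only [← Complex.coe_smul, smul_smul]
      congr 1
      have hrc : (r : ℂ) ≠ 0 := by exact_mod_cast hr.ne'
      push_cast
      rw [pow_succ (r : ℂ) (2 * (k + 1))]
      have e1 : Complex.I * r * R = Complex.I * (R * r) := by ring
      have e2 : -(Complex.I * r * R) = Complex.I * (-R * r) := by ring
      rw [e2, e1]
      field_simp
  · intro i hi
    have hi : i ≤ k + 1 := by have := Finset.mem_range.1 hi; omega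
    have h := (hZi i hi).integrable_integral_ray volume
    rw [finrank_euclideanSpace_fin, Nat.add_sub_cancel] at h
    exact h.smul (c i)

end reduction

/-! ### Fourier inversion at the origin for Schwartz functions. -/

section inversion

open FourierTransform

theorem fourierHat_eq_fourier {n : ℕ} {X : Type*} [NormedAddCommGroup X] [NormedSpace ℂ X]
    (f : EuclideanSpace ℝ (Fin n) → X) (ξ : EuclideanSpace ℝ (Fin n)) :
    fourierHat f ξ = 𝓕 f ((2 * Real.pi)⁻¹ • ξ) := by
  rw [Real.fourier_eq', fourierHat]
  congr 1
  funext s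
  rw [inner_smul_right, real_inner_comm]
  congr 2
  have : (Real.pi : ℂ) ≠ 0 := by exact_mod_cast Real.pi_ne_zero
  push_cast
  field_simp

theorem SchwartzMap.tendsto_sphericalPartialIntegral_zero {n : ℕ}
    (f : SchwartzMap (EuclideanSpace ℝ (Fin n)) ℂ) :
    Tendsto (fun R : ℝ => sphericalPartialIntegral f R 0) atTop (nhds (f 0)) := by
  have hpi : (0 : ℝ) < (2 * Real.pi)⁻¹ := by positivity
  have hi : Integrable (𝓕 (f : EuclideanSpace ℝ (Fin n) → ℂ)) := by
    rw [← SchwartzMap.fourier_coe]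
    exact (𝓕 f).integrable
  have hhat : fourierHat (f : EuclideanSpace ℝ (Fin n) → ℂ) =
      fun ξ => 𝓕 (f : EuclideanSpace ℝ (Fin n) → ℂ) ((2 * Real.pi)⁻¹ • ξ) := by
    funext ξ
    exact fourierHat_eq_fourier _ _
  have hinv : 𝓕⁻ (𝓕 (f : EuclideanSpace ℝ (Fin n) → ℂ)) 0 = f 0 :=
    f.integrable.fourierInv_fourier_eq hi f.continuous.continuousAt
  rw [Real.fourierInv_eq] at hinv
  simp only [inner_zero_right, AddChar.map_zero_eq_one, one_smul] at hinv
  have hi' : Integrable (fourierHat (f : EuclideanSpace ℝ (Fin n) → ℂ)) := by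
    rw [hhat]
    exact hi.comp_smul hpi.ne'
  have h := ((aecover_closedBall (μ := volume) (x := (0 : EuclideanSpace ℝ (Fin n)))
    (tendsto_id (x := (atTop : Filter ℝ)))).integral_tendsto_of_countably_generated hi').const_smul
      (1 / (2 * Real.pi) ^ n : ℝ)
  have hval : (1 / (2 * Real.pi) ^ n : ℝ) •
      ∫ ξ, fourierHat (f : EuclideanSpace ℝ (Fin n) → ℂ) ξ = f 0 := by
    rw [hhat, Measure.integral_comp_smul, hinv, finrank_euclideanSpace_fin, smul_smul,
      abs_of_nonneg (by positivity)]
    have : (1 / (2 * Real.pi) ^ n * ((2 * Real.pi)⁻¹ ^ n)⁻¹ : ℝ) = 1 := by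
      rw [inv_pow, inv_inv]
      field_simp
    rw [this, one_smul]
  rw [hval] at h
  refine h.congr fun R => ?_
  simp [sphericalPartialIntegral]

end inversion

/-! ### The decay hypothesis and the splitting of the partial integral. -/

section decomposition

variable {X : Type*} [NormedAddCommGroup X] [NormedSpace ℂ X]

theorem farBound_of_multiDeriv {k : ℕ} {F : EuclideanSpace ℝ (Fin (2 * (k + 1) + 1)) → X}
    (hF : ContDiff ℝ (k + 1 : ℕ) F) {K : Set (EuclideanSpace ℝ (Fin (2 * (k + 1) + 1)))}
    {δ : ℝ} {g : EuclideanSpace ℝ (Fin (2 * (k + 1) + 1)) → ℝ}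
    (h : ∀ y : EuclideanSpace ℝ (Fin (2 * (k + 1) + 1)), δ ≤ ‖y‖ →
      ∀ α : Fin (2 * (k + 1) + 1) → ℕ, ∑ i, α i ≤ k + 1 → ∀ x ∈ K,
        ‖y‖ ^ (-((2 * (k + 1) + 1 : ℕ) : ℤ) + ((k + 1 : ℕ) : ℤ)) * ‖multiDeriv α F (x + y)‖ ≤ g y)
    {b : EuclideanSpace ℝ (Fin (2 * (k + 1) + 1)) → ℝ} {ρ : ℝ}
    (hb : tsupport b ⊆ Metric.closedBall 0 ρ) :
    FarBound b F (k + 1) K (max δ (max 1 (ρ + 1)))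
      (fun y => ((2 * (k + 1) + 1 : ℕ) : ℝ) ^ (k + 1) * |g y|) := by
  -- Beyond radius `ρ + 1` the bump is absent and only derivatives of `F` remain. The powers then
  -- add up to the dimension: `(k + 1 - i) + i + (k + 2) = 2k + 3`.
  refine ⟨(le_max_left _ _).trans (le_max_right _ _), fun y hy x hx i hi => ?_⟩
  have hyδ : δ ≤ ‖y‖ := (le_max_left _ _).trans hy
  have hy1 : 1 ≤ ‖y‖ := ((le_max_left _ _).trans (le_max_right _ _)).trans hy
  have hyρ : ρ + 1 ≤ ‖y‖ := ((le_max_right _ _).trans (le_max_right _ _)).trans hy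
  have hnot : y ∉ tsupport b := fun hm => by
    have := mem_closedBall_zero_iff.1 (hb hm)
    linarith
  have hB : ∀ α : Fin (2 * (k + 1) + 1) → ℕ, ∑ i, α i ≤ k + 1 →
      ‖multiDeriv α F (x + y)‖ ≤ ‖y‖ ^ (k + 2) * |g y| := by
    intro α hα
    have e : (-((2 * (k + 1) + 1 : ℕ) : ℤ) + ((k + 1 : ℕ) : ℤ)) = -((k + 2 : ℕ) : ℤ) := by
      push_cast; ring
    have h1 := (h y hyδ α hα x hx).trans (le_abs_self _)
    rw [e, zpow_neg, zpow_natCast, inv_mul_le_iff₀ (by positivity)] at h1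
    exact h1
  have h2 := norm_iteratedFDeriv_apply_le_of_multiDeriv hF hB hi y
  rw [bumpDefect_of_notMem_tsupport hnot, finrank_euclideanSpace_fin]
  have h3 : (((2 * (k + 1) + 1 : ℕ) : ℝ)) ^ i ≤ ((2 * (k + 1) + 1 : ℕ) : ℝ) ^ (k + 1) :=
    pow_le_pow_right₀ (by exact_mod_cast Nat.succ_pos _) hi
  calc _ ≤ ‖y‖ ^ (k + 1 - i) * (((2 * (k + 1) + 1 : ℕ) : ℝ) ^ (k + 1) * ‖y‖ ^ i *
        (‖y‖ ^ (k + 2) * |g y|)) := by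
        gcongr
        refine h2.trans ?_
        gcongr
    _ = (‖y‖ ^ (k + 1 - i) * ‖y‖ ^ i) * ‖y‖ ^ (k + 2) *
        (((2 * (k + 1) + 1 : ℕ) : ℝ) ^ (k + 1) * |g y|) := by ring
    _ = _ := by
        rw [← pow_add, ← pow_add, Nat.sub_add_cancel hi]
        congr 2
        ring

variable [CompleteSpace X]

/-- In the subtracted term `F x` is constant in `y`, so the kernel integral of `b` is its own
partial integral, evaluated at `0`. -/
theorem sphericalPartialIntegral_eq_add {k : ℕ}
    {F : EuclideanSpace ℝ (Fin (2 * k + 1)) → X} (hF : Integrable F)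
    {b : EuclideanSpace ℝ (Fin (2 * k + 1)) → ℝ} (hb : Integrable b) {R : ℝ} (hR : 0 ≤ R)
    (x : EuclideanSpace ℝ (Fin (2 * k + 1))) :
    sphericalPartialIntegral F R x =
      sphericalConst k • (∫ y, besselKernel k R ‖y‖ • (F (x + y) - b y • F x)) +
        sphericalPartialIntegral (fun y => (b y : ℂ)) R 0 • F x := by
  have hbc : Integrable fun y => (b y : ℂ) := hb.ofReal
  rw [sphericalPartialIntegral_eq k hF hR, sphericalPartialIntegral_eq k hbc hR, smul_eq_mul,
    mul_smul, ← smul_add]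
  congr 1
  simp only [zero_add]
  have hd : Integrable fun y => F (x + y) - b y • F x :=
    (hF.comp_add_left x).sub (hb.smul_const (F x))
  rw [← integral_smul_const, ← integral_add (hd.besselKernel_norm_smul k R)
    ((hbc.besselKernel_norm_smul k R).smul_const (F x))]
  congr 1
  funext y
  rw [smul_eq_mul, mul_smul, ← smul_add, Complex.coe_smul]
  simp

theorem tendsto_neg_id_cocompact : Tendsto (fun R : ℝ => -R) atTop (cocompact ℝ) :=
  tendsto_neg_atTop_atBot.mono_right atBot_le_cocompact

end decomposition

/-! ### Conclusion. -/

theorem mainTheorem4 {X : Type*} [NormedAddCommGroup X] [NormedSpace ℂ X] [CompleteSpace X]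
    (n k : ℕ) (hn : n = 2 * k + 1) (hn3 : 3 ≤ n)
    (F : EuclideanSpace ℝ (Fin n) → X)
    (hF : Integrable F) (hFk : ContDiff ℝ k F)
    (hloc : ∀ K : Set (EuclideanSpace ℝ (Fin n)), IsCompact K →
      ∃ δ : ℝ, 0 < δ ∧ ∃ g : EuclideanSpace ℝ (Fin n) → ℝ, Integrable g ∧
        ∀ y : EuclideanSpace ℝ (Fin n), δ ≤ ‖y‖ →
          ∀ α : Fin n → ℕ, ∑ i, α i ≤ k → ∀ x ∈ K,
            ‖y‖ ^ (-(n : ℤ) + (k : ℤ)) * ‖multiDeriv α F (x + y)‖ ≤ g y) :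
    TendstoLocallyUniformly (fun (R : ℝ) => sphericalPartialIntegral F R) F atTop := by
  -- The bound `3 ≤ n` forces `k ≥ 1`, which supplies the derivative used to control the defect near
  -- `0`.
  obtain ⟨k, rfl⟩ : ∃ m, k = m + 1 := ⟨k - 1, by omega⟩
  subst hn
  rw [tendstoLocallyUniformly_iff_forall_tendsto]
  intro x₀
  obtain ⟨δ, -, g, hg, hbound⟩ := hloc _ (isCompact_closedBall x₀ 1)
  let b : ContDiffBump (0 : EuclideanSpace ℝ (Fin (2 * (k + 1) + 1))) :=
    ⟨1 / 2, 1, by norm_num, by norm_num⟩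
  have hfar := farBound_of_multiDeriv hFk hbound (b := b) (ρ := 1) b.tsupport_eq.subset
  have hbi : Integrable b := b.continuous.integrable_of_hasCompactSupport b.hasCompactSupport
  have hb0 : b 0 = 1 := b.one_of_mem_closedBall (by simp [b])
  have hbk : ContDiff ℝ (k + 1 : ℕ) b := b.contDiff
  have hg' : Integrable (fun y => ((2 * (k + 1) + 1 : ℕ) : ℝ) ^ (k + 1) * |g y|) :=
    hg.abs.const_mul _
  have hK : Metric.closedBall x₀ 1 ∈ nhds x₀ := Metric.closedBall_mem_nhds _ one_pos
  have hKc := isCompact_closedBall x₀ 1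
  have hgauge : Tendsto (fun R : ℝ => sphericalPartialIntegral (fun y => ((b y : ℝ) : ℂ)) R 0)
      atTop (nhds 1) := by
    have hs : HasCompactSupport (fun y => ((b y : ℝ) : ℂ)) :=
      b.hasCompactSupport.comp_left (g := fun r : ℝ => (r : ℂ)) (by simp)
    have h := (hs.toSchwartzMap (Complex.ofRealCLM.contDiff.comp b.contDiff)
      ).tendsto_sphericalPartialIntegral_zero
    have h1 : ((b 0 : ℝ) : ℂ) = 1 := by simp [hb0]
    rw [← h1]
    exact h
  have hosc : ∀ i ≤ k + 1, ∀ u : ℝ → ℝ, Tendsto u atTop (cocompact ℝ) →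
      Tendsto (fun p : ℝ × EuclideanSpace ℝ (Fin (2 * (k + 1) + 1)) =>
        ∫ y, Complex.exp (Complex.I * ((u p.1 * ‖y‖ : ℝ) : ℂ)) • radialDensity b F i p.2 y)
        (atTop ×ˢ nhds x₀) (nhds 0) := by
    intro i hi u hu
    have hle : (i : WithTop ℕ∞) ≤ (k + 1 : ℕ) := by exact_mod_cast hi
    refine tendsto_integral_exp_norm_smul_family volume ?_
      (tendsto_integral_norm_radialDensity_sub (by omega) hi hbk hFk hb0 hKc hg' hfar hK) hu
    obtain ⟨H, hH, hHb⟩ := exists_integrable_norm_radialDensity_le (by omega) hi hbk hFk hb0 hKc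
      hg' hfar
    filter_upwards [hK] with x hx
    exact hH.mono' (aestronglyMeasurable_radialDensity (hbk.of_le hle) (hFk.of_le hle) x)
      (Eventually.of_forall (hHb x hx))
  obtain ⟨c, hc⟩ := exists_integral_besselKernel_bumpDefect X k
  have hFx : Tendsto (fun p : ℝ × EuclideanSpace ℝ (Fin (2 * (k + 1) + 1)) => F p.2)
      (atTop ×ˢ nhds x₀) (nhds (F x₀)) := (hFk.continuous.tendsto x₀).comp tendsto_snd
  have hsum := tendsto_finsetSum (Finset.range (k + 2)) fun i hi =>
    have hi : i ≤ k + 1 := Nat.lt_succ_iff.1 (Finset.mem_range.1 hi)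
    ((hosc i hi _ atTop_le_cocompact).sub
      (hosc i hi _ tendsto_neg_id_cocompact)).const_smul (c i)
  have hlim := (hsum.const_smul (sphericalConst (k + 1))).add
    ((hgauge.comp tendsto_fst).smul hFx)
  simp only [sub_self, smul_zero, Finset.sum_const_zero, zero_add, one_smul] at hlim
  -- Both `F x` and `S_R(F)(x)` tend to `F x₀` as `R → ∞` and `x → x₀` jointly, so the pair enters
  -- every entourage.
  refine (hFx.prodMk_nhds (hlim.congr' ?_)).mono_right (nhds_le_uniformity (F x₀))
  filter_upwards [tendsto_fst.eventually (eventually_ge_atTop (0 : ℝ)),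
    tendsto_snd.eventually hK] with p hp1 hp2
  rw [sphericalPartialIntegral_eq_add hF hbi hp1,
    hc b F _ _ _ hKc hbk hFk hb0 hbi hF hg' hfar _ hp2]
  rfl
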